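/- Let $\mathbb T^d$ be the $d$-torus with unit $\mathbf 1$. For $\boldsymbol s\in\mathbb T^d$ and $\boldsymbol p\in\mathbb Z^d$ write $\boldsymbol s^{\boldsymbol p}=s_1^{p_1}\cdots s_d^{p_d}$, $\Re\boldsymbol s=(\Re s_j)_j$, $\Im\boldsymbol s=(\Im s_j)_j$, $\arg\boldsymbol s=(\arg s_j)_j$ with $\arg s_j\in(-\pi,\pi]$, and $\mathscr U_\epsilon=\{\boldsymbol s:\|\arg\boldsymbol s\|<\epsilon\}$, where $\|\cdot\|$ is the Euclidean norm. Exponentials of vectors are taken coordinatewise, and $\circledast$ is the convolution of probability measures on the group $\mathbb T^d$. A *Lévy measure* is a positive Borel measure $\rho$ on $\mathbb T^d$ with $\rho(\{\mathbf 1\})=0$ and $\|\mathbf 1-\Re\boldsymbol s\|\in L^1(\rho)$. A *multiplicative Lévy triplet* $(\boldsymbol\gamma,\mathbf A,\rho)$ consists of $\boldsymbol\gamma\in\mathbb T^d$, a positive semi-definite symmetric real $d\times d$ matrix $\mathbf A$ and a Lévy measure $\rho$. A probability measure $\nu$ on $\mathbb T^d$ *has* this triplet if $$\int_{\mathbb T^d}\boldsymbol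 s^{\boldsymbol p}\,d\nu(\boldsymbol s)=\boldsymbol\gamma^{\boldsymbol p}\exp\Big(-\tfrac12\langle\mathbf A\boldsymbol p,\boldsymbol p\rangle+\int_{\mathbb T^d}\big(\boldsymbol s^{\boldsymbol p}-1-i\langle\boldsymbol p,\Im\boldsymbol s\rangle\big)\,d\rho(\boldsymbol s)\Big),\qquad \boldsymbol p\in\mathbb Z^d .$$ For every multiplicative Lévy triplet there is exactly one such $\nu$; it is denoted by $\nu_\circledast^{(\boldsymbol\gamma,\mathbf A,\rho)}$. Let $\mathcal L(\rho)$ be the set of all measures $\rho'$ that serve as Lévy measures for $\nu_\circledast^{(\mathbf 1,\mathbf 0,\rho)}$, i.e. such that this distribution has the triplet $(\boldsymbol\gamma',\mathbf A',\rho')$ for some $\boldsymbol\gamma',\mathbf A'$. Let $\tilde{\mathscr M}$ be the set of positive Borel measures on $\mathbb T^d$ that do not charge $\mathbf 1$ and are finite on Borel sets bounded away from $\mathbf 1$; $\sigma_n$ converges to $\sigma$ in $\tilde{\mathscr M}$ if $\int f\,d\sigma_n\to\int f\,d\sigma$ for every bounded continuous $f$ whose support is bounded away from $\mathbf 1$.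 A subset of $\tilde{\mathscr M}$ is relatively compact if every sequence in it has a subsequence that converges in $\tilde{\mathscr M}$, and the limit points of a sequence are the limits in $\tilde{\mathscr M}$ of its convergent subsequences. Fix $\theta\in(0,1)$. Let $\{\nu_{nk}\}_{n\ge1,\,1\le k\le k_n}$ be an infinitesimal triangular array of probability measures on $\mathbb T^d$: $k_1<k_2<\cdots$, and for every neighbourhood $U$ of $\mathbf 1$, $\max_{1\le k\le k_n}\nu_{nk}(\mathbb T^d\setminus U)\to0$ as $n\to\infty$. Let $\{\boldsymbol\xi_n\}\subset\mathbb T^d$. Put $$\boldsymbol b_{nk}=\exp\Big[i\int_{\mathscr U_\theta}\arg\boldsymbol s\,d\nu_{nk}(\boldsymbol s)\Big],\qquad \mathring\nu_{nk}(B)=\nu_{nk}(\boldsymbol b_{nk}B),\qquad \rho_n=\sum_{k=1}^{k_n}\mathring\nu_{nk},$$ $$\boldsymbol\gamma_n=\boldsymbol\xi_n\exp\Big[i\sum_{k=1}^{k_n}\Big(\arg\boldsymbol b_{nk}+\int_{\mathbb T^d}\Im\boldsymbol s\,d\mathring\nu_{nk}(\boldsymbol s)\Big)\Big].$$ **Theorem.**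 Let $(\boldsymbol\gamma,\mathbf A,\rho)$ be a multiplicative Lévy triplet. Then $\delta_{\boldsymbol\xi_n}\circledast\nu_{n1}\circledast\cdots\circledast\nu_{nk_n}$ converges weakly to $\nu_\circledast^{(\boldsymbol\gamma,\mathbf A,\rho)}$ as $n\to\infty$ if and only if the following three statements hold: 1. $\lim_{n\to\infty}\boldsymbol\gamma_n=\boldsymbol\gamma$; 2. for all $1\le j,\ell\le d$ both limits $$\lim_{\epsilon\downarrow0}\limsup_{n\to\infty}\int_{\mathscr U_\epsilon}(\Im s_j)(\Im s_\ell)\,d\rho_n\quad\text{and}\quad\lim_{\epsilon\downarrow0}\liminf_{n\to\infty}\int_{\mathscr U_\epsilon}(\Im s_j)(\Im s_\ell)\,d\rho_n$$ exist and equal the $(j,\ell)$-entry of $\mathbf A$; 3. the sequence $\{1_{\mathbb T^d\setminus\{\mathbf 1\}}\rho_n\}$ is relatively compact in $\tilde{\mathscr M}$ and all of its limit points belong to $\mathcal L(\rho)$. -/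

import Mathlib

open MeasureTheory Filter Topology

noncomputable section

/-- The `d`-torus, a compact abelian group under coordinatewise multiplication, with its product
topology (the one inherited from `ℂ^d`). -/
abbrev Torus (d : ℕ) : Type := Fin d → Circle

instance : MeasurableSpace Circle := borel Circle

instance : BorelSpace Circle := ⟨rfl⟩

namespace Torus

variable {d : ℕ}

/-- `arg s = (arg s_1, …, arg s_d)`, with principal arguments in `(-π, π]`, as a vector of
Euclidean space. -/
def argVec (s : Torus d) : EuclideanSpace ℝ (Fin d) :=
  WithLp.toLp 2 fun j => Complex.arg (s j : ℂ)

/-- `1 - Re s = (1 - Re s_1, …, 1 - Re s_d)`, as a vector of Euclidean space. -/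
def oneSubRe (s : Torus d) : EuclideanSpace ℝ (Fin d) :=
  WithLp.toLp 2 fun j => 1 - (s j : ℂ).re

/-- The neighbourhood `U_ε = {s : ‖arg s‖ < ε}` of the unit. -/
def nhd (d : ℕ) (ε : ℝ) : Set (Torus d) := {s | ‖argVec s‖ < ε}

/-- `s^p = s_1^{p_1} ⋯ s_d^{p_d}`. -/
def monomial (p : Fin d → ℤ) (s : Torus d) : ℂ := ∏ j, (s j : ℂ) ^ p j

/-- `⟨p, Im s⟩`. -/
def pairIm (p : Fin d → ℤ) (s : Torus d) : ℝ := ∑ j, (p j : ℝ) * (s j : ℂ).im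

/-- The characteristic function (moment sequence) of a measure on the torus. -/
def charFn (μ : Measure (Torus d)) (p : Fin d → ℤ) : ℂ := ∫ s, monomial p s ∂μ

/-! ### Convolution -/

/-- The convolution `μ ⊛ ν`: the law of the product of two independent points. -/
def conv (μ ν : ProbabilityMeasure (Torus d)) : ProbabilityMeasure (Torus d) :=
  ⟨(μ : Measure (Torus d)).mconv (ν : Measure (Torus d)), inferInstance⟩

/-- The Dirac measure at `ξ`. -/
def diracProb (ξ : Torus d) : ProbabilityMeasure (Torus d) := ⟨Measure.dirac ξ, inferInstance⟩

/-- `δ_ξ ⊛ ν_1 ⊛ ⋯ ⊛ ν_m`. -/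
def rowConv (ξ : Torus d) {m : ℕ} (ν : Fin m → ProbabilityMeasure (Torus d)) :
    ProbabilityMeasure (Torus d) :=
  (List.ofFn ν).foldl conv (diracProb ξ)

/-! ### Lévy triplets -/

/-- Lévy measures on the torus. -/
structure IsLevyMeasure (ρ : Measure (Torus d)) : Prop where
  one : ρ {1} = 0
  integrable : Integrable (fun s => ‖oneSubRe s‖) ρ

/-- The quadratic form `⟨A p, p⟩`. -/
def quadForm (A : Matrix (Fin d) (Fin d) ℝ) (p : Fin d → ℤ) : ℝ :=
  ∑ j, ∑ l, A j l * (p j : ℝ) * (p l : ℝ)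

/-- `γ^p exp(-⟨Ap, p⟩ / 2 + ∫ (s^p - 1 - i⟨p, Im s⟩) dρ(s))`. -/
def levyKhintchine (γ : Torus d) (A : Matrix (Fin d) (Fin d) ℝ) (ρ : Measure (Torus d))
    (p : Fin d → ℤ) : ℂ :=
  monomial p γ * Complex.exp (-(quadForm A p : ℂ) / 2 +
    ∫ s, (monomial p s - 1 - Complex.I * (pairIm p s : ℂ)) ∂ρ)

/-- `(γ, A, ρ)` is a multiplicative Lévy triplet (`γ` may be any point of the torus). -/
structure IsLevyTriplet (_γ : Torus d) (A : Matrix (Fin d) (Fin d) ℝ) (ρ : Measure (Torus d)) :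
    Prop where
  posSemidef : A.PosSemidef
  levy : IsLevyMeasure ρ

/-- `ν` is the distribution `ν_⊛^{(γ,A,ρ)}`, i.e. it has the multiplicative Lévy triplet
`(γ, A, ρ)`. -/
structure HasLevyTriplet (ν : ProbabilityMeasure (Torus d)) (γ : Torus d)
    (A : Matrix (Fin d) (Fin d) ℝ) (ρ : Measure (Torus d)) : Prop where
  triplet : IsLevyTriplet γ A ρ
  charFn_eq : ∀ p : Fin d → ℤ, charFn (ν : Measure (Torus d)) p = levyKhintchine γ A ρ p

/-- `𝓛(ρ)`: all measures serving as Lévy measures of the distribution `ν_⊛^{(1,0,ρ)}`. -/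
def levyClass (ρ : Measure (Torus d)) : Set (Measure (Torus d)) :=
  {ρ' | ∃ ν : ProbabilityMeasure (Torus d), HasLevyTriplet ν 1 0 ρ ∧
    ∃ (γ' : Torus d) (A' : Matrix (Fin d) (Fin d) ℝ), HasLevyTriplet ν γ' A' ρ'}

/-! ### Vague convergence away from the unit -/

/-- A set is bounded away from the unit. (The supremum metric on the product is used; it is
equivalent to the metric of `ℂ^d`.) -/
def AwayFromOne (B : Set (Torus d)) : Prop := ∃ r : ℝ, 0 < r ∧ ∀ s ∈ B, r ≤ dist s 1

/-- The space of positive Borel measures that are finite on Borel sets bounded away from the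
unit and do not charge the unit. -/
def puncturedMeasures (d : ℕ) : Set (Measure (Torus d)) :=
  {τ | τ {1} = 0 ∧ ∀ B : Set (Torus d), MeasurableSet B → AwayFromOne B → τ B < ⊤}

/-- Convergence `τ_n ⇒_1 τ`: convergence of the integrals of all bounded continuous functions
whose support is bounded away from the unit. -/
def VagueTendsto (σ : ℕ → Measure (Torus d)) (τ : Measure (Torus d)) : Prop :=
  ∀ f : BoundedContinuousFunction (Torus d) ℝ, AwayFromOne (Function.support f) →
    Tendsto (fun n => ∫ s, f s ∂(σ n)) atTop (𝓝 (∫ s, f s ∂τ))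

/-- Relative compactness in the (metrizable) space `puncturedMeasures d`: every sequence in `Y`
has a subsequence converging in that space. -/
def VagueRelCompact (Y : Set (Measure (Torus d))) : Prop :=
  ∀ u : ℕ → Measure (Torus d), (∀ m, u m ∈ Y) →
    ∃ φ : ℕ → ℕ, StrictMono φ ∧ ∃ τ ∈ puncturedMeasures d, VagueTendsto (fun m => u (φ m)) τ

/-- `τ` is a limit point of the sequence `σ` in the space `puncturedMeasures d`. -/
def IsVagueLimitPoint (σ : ℕ → Measure (Torus d)) (τ : Measure (Torus d)) : Prop :=
  τ ∈ puncturedMeasures d ∧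
    ∃ φ : ℕ → ℕ, StrictMono φ ∧ VagueTendsto (fun m => σ (φ m)) τ

/-! ### Triangular arrays -/

/-- Infinitesimal triangular arrays. -/
structure IsInfinitesimal (k : ℕ → ℕ)
    (ν : (n : ℕ) → Fin (k n) → ProbabilityMeasure (Torus d)) : Prop where
  strictMono : StrictMono k
  tendsto : ∀ ε : ℝ, 0 < ε →
    Tendsto (fun n => ⨆ i : Fin (k n), (ν n i : Measure (Torus d)) {s | ε ≤ dist s 1})
      atTop (𝓝 0)

/-- `b = exp(i ∫_{U_θ} arg s dν(s))`. -/
def centering (θ : ℝ) (ν : ProbabilityMeasure (Torus d)) : Torus d :=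
  fun j => Circle.exp (∫ s in nhd d θ, Complex.arg (s j : ℂ) ∂(ν : Measure (Torus d)))

/-- The rotated measure `B ↦ ν(b B)`, where `b` is the centering of `ν`. -/
def rotated (θ : ℝ) (ν : ProbabilityMeasure (Torus d)) : Measure (Torus d) :=
  (ν : Measure (Torus d)).map fun s => (centering θ ν)⁻¹ * s

/-- `ρ_n = ∑_k ν̊_{nk}` for one row of the array. -/
def rowMeasure (θ : ℝ) {m : ℕ} (ν : Fin m → ProbabilityMeasure (Torus d)) :
    Measure (Torus d) :=
  ∑ i, rotated θ (ν i)

/-- `γ_n = ξ_n exp(i ∑_k (arg b_{nk} + ∫ Im s dν̊_{nk}(s)))` for one row of the array. -/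
def rowDrift (θ : ℝ) (ξ : Torus d) {m : ℕ} (ν : Fin m → ProbabilityMeasure (Torus d)) :
    Torus d :=
  fun j => ξ j * Circle.exp
    (∑ i, (Complex.arg (centering θ (ν i) j : ℂ) + ∫ s, (s j : ℂ).im ∂(rotated θ (ν i))))

/-- `∫_{U_ε} (Im s_j)(Im s_l) dρ(s)`. -/
def truncMoment (ρ : Measure (Torus d)) (ε : ℝ) (j l : Fin d) : ℝ :=
  ∫ s in nhd d ε, (s j : ℂ).im * (s l : ℂ).im ∂ρ

end Torus

end

/-!
The argument runs through characteristic functions on `ℤ^d` and the radial weight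
`gap s = ∑ⱼ (1 - Re sⱼ)`, which is comparable to the squared distance to the unit.

*Existence and uniqueness.* Trigonometric polynomials separate points, so a finite measure is
determined by its characteristic function (`measure_ext_of_charFn`); as the space of probability
measures on the compact torus is compact, weak convergence is the same as pointwise convergence of
characteristic functions (`tendsto_iff_charFn`), and pointwise limits of characteristic functions
are characteristic functions. Compound Poisson laws are limits of powers of mixtures with the
point mass at the unit; Gaussian laws and general Lévy measures are limits of compound Poisson
laws (`existsUnique_hasLevyTriplet`).

*Accompanying laws.* Subtracting the truncated mean argument leaves a mean displacement of the
order of the second-order size `∫ gap` of a law (`isCentered_rotated`). Hence every characteristic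
coefficient of a centered law differs from `1` by `O(∫ gap)`, and, as long as the total `∫ gap dρₙ`
stays bounded, the characteristic function of a row is asymptotically
`γₙ^p exp (∫ (s^p - 1 - i⟨p, Im s⟩) dρₙ)` (`IsInfinitesimal.tendsto_charFn_rowConv_sub`). If the
rows converge, the moduli of their coefficients at the frequencies `eⱼ` stay away from zero, and
this bounds `∫ gap dρₙ` (`exists_integral_gap_rowMeasure_le`). At these frequencies the exponent is
real, so the phase alone gives the convergence of the drifts (`tendsto_rowDrift`).

*Compactness.* If `∫ gap dσₙ` is bounded, the finite measures `gap · σₙ` have a weakly convergent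
subsequence. The limit splits into a Lévy measure `τ` away from the unit and a covariance `A'` that
records the second-order mass at the unit (`exists_subseq_condensedLimit`), and the
Lévy–Khintchine integrals of `σₙ` converge to the exponent of `(A', τ)`
(`CondensedLimit.tendsto_lkIntegral`).

*Identification.* On the torus the exponent is determined only up to imaginary multiples of `2π`, so
`τ` need not be `ρ`. The real part is determined, though: its quadratic growth along `n • p` yields
`A' = A` (`covariance_unique`), and what remains says that `τ` belongs to the class of `ρ`
(`condensedLimit_eq`, `mem_levyClass_iff`). The iterated limits of the second moments need more,
since `τ` depends on the subsequence: the real parts `∫ (1 - Re sⱼ^n) dτ`, common to the whole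
class, bound `∫ gap dτ` near the unit uniformly over the class (`exists_forall_nearMass_le`).

For the converse, the moment condition near the unit and vague convergence away from it bound
`∫ gap dρₙ` along a subsequence of any given subsequence (`eventually_integral_gap_le`); the
compactness argument and the accompanying laws then identify the limit of the rows.
-/

namespace Torus

variable {d : ℕ}

/-! ### The radial function and pointwise estimates -/

/-- The radial function `∑ⱼ (1 - Re sⱼ)`, comparable to the squared distance to the unit. It is
smooth, vanishes only at the unit, and serves as the weight that turns Lévy measures into finite
measures. -/
noncomputable def gap (s : Torus d) : ℝ := ∑ j, (1 - (s j : ℂ).re)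

theorem circle_re (z : Circle) : (z : ℂ).re = Real.cos (Complex.arg z) := by
  rw [← Complex.norm_mul_cos_arg (z : ℂ), Circle.norm_coe, one_mul]

theorem circle_im (z : Circle) : (z : ℂ).im = Real.sin (Complex.arg z) := by
  rw [← Complex.norm_mul_sin_arg (z : ℂ), Circle.norm_coe, one_mul]

theorem circle_re_le (z : Circle) : (z : ℂ).re ≤ 1 := by
  rw [circle_re]; exact Real.cos_le_one _

theorem neg_one_le_circle_re (z : Circle) : -1 ≤ (z : ℂ).re := by
  rw [circle_re]; exact Real.neg_one_le_cos _

theorem circle_im_sq (z : Circle) : (z : ℂ).im ^ 2 = (1 - (z : ℂ).re) * (1 + (z : ℂ).re) := by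
  rw [circle_re, circle_im]; nlinarith [Real.sin_sq_add_cos_sq (Complex.arg (z : ℂ))]

theorem two_div_pi_sq_mul_sq_le {x : ℝ} (hx : |x| ≤ Real.pi) :
    2 / Real.pi ^ 2 * x ^ 2 ≤ 1 - Real.cos x := by
  have := Real.cos_le_one_sub_mul_cos_sq hx; linarith

theorem sq_le_five_mul {x : ℝ} (hx : |x| ≤ Real.pi) : x ^ 2 ≤ 5 * (1 - Real.cos x) := by
  have h := two_div_pi_sq_mul_sq_le hx
  have hpi : Real.pi ^ 2 ≤ 10 := by nlinarith [Real.pi_lt_d2, Real.pi_pos]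
  have h2 : (1 / 5 : ℝ) ≤ 2 / Real.pi ^ 2 := by
    rw [div_le_div_iff₀ (by norm_num) (by positivity)]; linarith
  nlinarith [sq_nonneg x]

theorem one_sub_cos_le (x : ℝ) : 1 - Real.cos x ≤ x ^ 2 / 2 := by
  have := Real.one_sub_sq_div_two_le_cos (x := x); linarith

theorem gap_nonneg (s : Torus d) : 0 ≤ gap s :=
  Finset.sum_nonneg fun _ _ => sub_nonneg.2 (circle_re_le _)

theorem one_sub_re_le_gap (s : Torus d) (j : Fin d) : 1 - (s j : ℂ).re ≤ gap s :=
  Finset.single_le_sum (f := fun j => 1 - (s j : ℂ).re)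
    (fun _ _ => sub_nonneg.2 (circle_re_le _)) (Finset.mem_univ j)

@[simp] theorem gap_one : gap (1 : Torus d) = 0 := by simp [gap]

theorem gap_eq_zero {s : Torus d} : gap s = 0 ↔ s = 1 := by
  refine ⟨fun h => ?_, fun h => h ▸ gap_one⟩
  funext j
  have h1 : (s j : ℂ).re = 1 :=
    le_antisymm (circle_re_le _) (by have := one_sub_re_le_gap s j; linarith)
  have h2 : (s j : ℂ).im = 0 := by
    have := circle_im_sq (s j); rw [h1] at this; simpa using this
  exact Circle.ext (Complex.ext (by simpa using h1) (by simpa using h2))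

theorem gap_pos {s : Torus d} (h : s ≠ 1) : 0 < gap s :=
  lt_of_le_of_ne (gap_nonneg s) fun h' => h (gap_eq_zero.1 h'.symm)

theorem gap_le (s : Torus d) : gap s ≤ 2 * d := by
  calc gap s ≤ ∑ _j : Fin d, (2 : ℝ) :=
        Finset.sum_le_sum fun j _ => by have := neg_one_le_circle_re (s j); linarith
    _ = 2 * d := by simp [mul_comm]

@[fun_prop] theorem continuous_gap : Continuous (gap : Torus d → ℝ) := by
  unfold gap; fun_prop

@[fun_prop] theorem continuous_monomial (p : Fin d → ℤ) : Continuous (monomial p) := by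
  unfold monomial
  refine continuous_finsetProd _ fun j _ => ?_
  have : (fun s : Torus d => (s j : ℂ) ^ p j) = fun s => (((s j) ^ p j : Circle) : ℂ) := by
    funext s; simp
  rw [this]
  have hc : Continuous fun z : Circle => (z : ℂ) := by fun_prop
  exact hc.comp ((continuous_apply j).zpow _)

@[fun_prop] theorem continuous_pairIm (p : Fin d → ℤ) : Continuous (pairIm p) := by
  unfold pairIm; fun_prop

theorem monomial_mul (p : Fin d → ℤ) (s t : Torus d) :
    monomial p (s * t) = monomial p s * monomial p t := by
  simp [monomial, mul_zpow, Finset.prod_mul_distrib]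

@[simp] theorem monomial_one (p : Fin d → ℤ) : monomial p 1 = 1 := by simp [monomial]

@[simp] theorem norm_monomial (p : Fin d → ℤ) (s : Torus d) : ‖monomial p s‖ = 1 := by
  simp [monomial, norm_prod, Circle.norm_coe]

theorem monomial_ne_zero (p : Fin d → ℤ) (s : Torus d) : monomial p s ≠ 0 := by
  rw [← norm_ne_zero_iff]; simp

theorem monomial_add (p q : Fin d → ℤ) (s : Torus d) :
    monomial (p + q) s = monomial p s * monomial q s := by
  simp only [monomial, Pi.add_apply, ← Finset.prod_mul_distrib]
  exact Finset.prod_congr rfl fun j _ => zpow_add₀ (by simp) _ _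

theorem monomial_neg (p : Fin d → ℤ) (s : Torus d) :
    monomial (-p) s = starRingEnd ℂ (monomial p s) := by
  have h1 : monomial (-p) s * monomial p s = 1 := by
    rw [← monomial_add]; simp [monomial]
  have h2 : starRingEnd ℂ (monomial p s) * monomial p s = 1 := by
    rw [mul_comm, Complex.mul_conj, Complex.normSq_eq_norm_sq]; simp
  exact mul_right_cancel₀ (monomial_ne_zero p s) (h1.trans h2.symm)

theorem monomial_zero (s : Torus d) : monomial 0 s = 1 := by simp [monomial]

theorem monomial_single (j : Fin d) (n : ℤ) (s : Torus d) :
    monomial (Pi.single j n) s = (s j : ℂ) ^ n := by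
  unfold monomial
  rw [Finset.prod_eq_single j]
  · simp
  · intro b _ hb; simp [Pi.single_eq_of_ne hb]
  · simp

theorem pairIm_single (j : Fin d) (s : Torus d) : pairIm (Pi.single j 1) s = (s j : ℂ).im := by
  unfold pairIm
  rw [Finset.sum_eq_single j]
  · simp
  · intro b _ hb; simp [Pi.single_eq_of_ne hb]
  · simp

/-- The phase `⟨p, arg s⟩`. -/
noncomputable def phase (p : Fin d → ℤ) (s : Torus d) : ℝ :=
  ∑ j, (p j : ℝ) * Complex.arg (s j : ℂ)

theorem coe_circle_eq_exp (z : Circle) : (z : ℂ) = Complex.exp (Complex.arg z * Complex.I) := by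
  rw [← Circle.coe_exp, Circle.exp_arg]

theorem monomial_eq_exp (p : Fin d → ℤ) (s : Torus d) :
    monomial p s = Complex.exp (phase p s * Complex.I) := by
  unfold monomial phase
  push_cast
  rw [Finset.sum_mul, Complex.exp_sum]
  refine Finset.prod_congr rfl fun j _ => ?_
  rw [mul_assoc, Complex.exp_int_mul, ← coe_circle_eq_exp]

theorem monomial_re (p : Fin d → ℤ) (s : Torus d) :
    (monomial p s).re = Real.cos (phase p s) := by
  rw [monomial_eq_exp, Complex.exp_ofReal_mul_I_re]

theorem monomial_nsmul (p : Fin d → ℤ) (n : ℕ) (s : Torus d) :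
    (monomial (n • p) s).re = Real.cos (n * phase p s) := by
  rw [monomial_re]
  congr 1
  simp [phase, Finset.mul_sum, mul_assoc]

theorem norm_exp_sub_taylor_two_le (y : ℝ) :
    ‖Complex.exp (y * Complex.I) - 1 - Complex.I * y‖ ≤ 3 * y ^ 2 := by
  have hI : ‖(y * Complex.I : ℂ)‖ = |y| := by simp
  rcases le_total |y| 1 with h | h
  · have h0 := Complex.norm_exp_sub_sum_le_norm_mul_exp (y * Complex.I) 2
    rw [hI, sq_abs] at h0
    have h1 : Real.exp |y| ≤ 3 := by
      calc Real.exp |y| ≤ Real.exp 1 := Real.exp_le_exp.2 h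
        _ ≤ 3 := by linarith [Real.exp_one_lt_d9]
    have h2 : Complex.exp (y * Complex.I) - 1 - Complex.I * y =
        Complex.exp (y * Complex.I) -
          ∑ m ∈ Finset.range 2, (y * Complex.I : ℂ) ^ m / (m.factorial : ℂ) := by
      simp [Finset.sum_range_succ]; ring
    rw [h2]
    nlinarith [sq_nonneg y]
  · have h3 : ‖Complex.exp (y * Complex.I) - 1 - Complex.I * y‖ ≤ 1 + 1 + |y| := by
      refine (norm_sub_le _ _).trans (add_le_add ((norm_sub_le _ _).trans ?_) ?_)
      · rw [Complex.norm_exp_ofReal_mul_I]; simp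
      · simp
    have : |y| ^ 2 = y ^ 2 := sq_abs y
    nlinarith

theorem norm_exp_sub_taylor_three_le (y : ℝ) :
    ‖Complex.exp (y * Complex.I) - 1 - Complex.I * y + y ^ 2 / 2‖ ≤ 4 * |y| ^ 3 := by
  have hI : ‖(y * Complex.I : ℂ)‖ = |y| := by simp
  rcases le_total |y| 1 with h | h
  · have h0 := Complex.norm_exp_sub_sum_le_norm_mul_exp (y * Complex.I) 3
    rw [hI] at h0
    have h1 : Real.exp |y| ≤ 3 := by
      calc Real.exp |y| ≤ Real.exp 1 := Real.exp_le_exp.2 h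
        _ ≤ 3 := by linarith [Real.exp_one_lt_d9]
    have h2 : Complex.exp (y * Complex.I) - 1 - Complex.I * y + y ^ 2 / 2 =
        Complex.exp (y * Complex.I) -
          ∑ m ∈ Finset.range 3, (y * Complex.I : ℂ) ^ m / (m.factorial : ℂ) := by
      simp [Finset.sum_range_succ, mul_pow]; ring
    rw [h2]
    have h3 : 0 ≤ |y| ^ 3 := by positivity
    nlinarith
  · have h3 := norm_exp_sub_taylor_two_le y
    have h4 : ‖(y : ℂ) ^ 2 / 2‖ = y ^ 2 / 2 := by simp
    have h5 := norm_add_le (Complex.exp (y * Complex.I) - 1 - Complex.I * y) ((y : ℂ) ^ 2 / 2)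
    have : |y| ^ 2 = y ^ 2 := sq_abs y
    have h6 : y ^ 2 ≤ |y| ^ 3 := by rw [← this]; exact pow_le_pow_right₀ h (by norm_num)
    have h7 : 0 ≤ |y| ^ 3 := by positivity
    linarith

theorem abs_sin_sub_le_cube (x : ℝ) : |Real.sin x - x| ≤ 4 * |x| ^ 3 := by
  have h := (Complex.abs_im_le_norm _).trans (norm_exp_sub_taylor_three_le x)
  have : (Complex.exp (x * Complex.I) - 1 - Complex.I * x + (x : ℂ) ^ 2 / 2).im
      = Real.sin x - x := by
    have h2 : ((x : ℂ) ^ 2 / 2).im = 0 := by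
      have : ((x : ℂ) ^ 2 / 2) = ((x ^ 2 / 2 : ℝ) : ℂ) := by push_cast; ring
      rw [this, Complex.ofReal_im]
    rw [Complex.add_im, h2]
    simp [Complex.exp_ofReal_mul_I_im]
  rwa [this] at h

theorem abs_sin_sub_le_sq (x : ℝ) : |Real.sin x - x| ≤ 3 * x ^ 2 := by
  have h := (Complex.abs_im_le_norm _).trans (norm_exp_sub_taylor_two_le x)
  simpa [Complex.exp_ofReal_mul_I_im] using h

theorem arg_sq_le (z : Circle) : Complex.arg (z : ℂ) ^ 2 ≤ 5 * (1 - (z : ℂ).re) := by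
  rw [circle_re]; exact sq_le_five_mul (Complex.abs_arg_le_pi _)

theorem abs_arg_le (s : Torus d) (j : Fin d) :
    |Complex.arg (s j : ℂ)| ≤ 3 * √(gap s) := by
  have h := arg_sq_le (s j)
  have h2 := one_sub_re_le_gap s j
  have h3 := Real.sq_sqrt (gap_nonneg s)
  refine abs_le_of_sq_le_sq ?_ (by positivity)
  nlinarith [gap_nonneg s]

/-- The `ℓ¹`-size of a frequency. -/
noncomputable def freqSize (p : Fin d → ℤ) : ℝ := ∑ j, |(p j : ℝ)|

theorem freqSize_nonneg (p : Fin d → ℤ) : 0 ≤ freqSize p :=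
  Finset.sum_nonneg fun _ _ => abs_nonneg _

theorem abs_sum_mul_le (p : Fin d → ℤ) {x : Fin d → ℝ} {c : ℝ} (h : ∀ j, |x j| ≤ c) :
    |∑ j, (p j : ℝ) * x j| ≤ freqSize p * c := by
  unfold freqSize
  rw [Finset.sum_mul]
  refine (Finset.abs_sum_le_sum_abs _ _).trans (Finset.sum_le_sum fun j _ => ?_)
  rw [abs_mul]
  exact mul_le_mul_of_nonneg_left (h j) (abs_nonneg _)

theorem abs_phase_le (p : Fin d → ℤ) (s : Torus d) :
    |phase p s| ≤ freqSize p * (3 * √(gap s)) := abs_sum_mul_le p (abs_arg_le s)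

theorem abs_pairIm_le (p : Fin d → ℤ) (s : Torus d) :
    |pairIm p s| ≤ freqSize p * (3 * √(gap s)) := by
  refine abs_sum_mul_le p fun j => ?_
  rw [circle_im]
  exact (Real.abs_sin_le_abs).trans (abs_arg_le s j)

theorem abs_phase_sub_pairIm_le_cube (p : Fin d → ℤ) (s : Torus d) :
    |phase p s - pairIm p s| ≤ freqSize p * (108 * √(gap s) ^ 3) := by
  have : phase p s - pairIm p s =
      ∑ j, (p j : ℝ) * (Complex.arg (s j : ℂ) - (s j : ℂ).im) := by
    simp [phase, pairIm, mul_sub]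
  rw [this]
  refine abs_sum_mul_le p fun j => ?_
  rw [circle_im, abs_sub_comm]
  refine (abs_sin_sub_le_cube _).trans ?_
  have := pow_le_pow_left₀ (abs_nonneg _) (abs_arg_le s j) 3
  calc _ ≤ 4 * (3 * √(gap s)) ^ 3 := by linarith
    _ = _ := by ring

theorem abs_phase_sub_pairIm_le_sq (p : Fin d → ℤ) (s : Torus d) :
    |phase p s - pairIm p s| ≤ freqSize p * (27 * √(gap s) ^ 2) := by
  have : phase p s - pairIm p s =
      ∑ j, (p j : ℝ) * (Complex.arg (s j : ℂ) - (s j : ℂ).im) := by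
    simp [phase, pairIm, mul_sub]
  rw [this]
  refine abs_sum_mul_le p fun j => ?_
  rw [circle_im, abs_sub_comm]
  refine (abs_sin_sub_le_sq _).trans ?_
  have := pow_le_pow_left₀ (abs_nonneg _) (abs_arg_le s j) 2
  rw [sq_abs] at this
  calc _ ≤ 3 * (3 * √(gap s)) ^ 2 := by linarith
    _ = _ := by ring

/-- The integrand `s^p - 1 - i⟨p, Im s⟩` of the Lévy–Khintchine formula. -/
noncomputable def lkIntegrand (p : Fin d → ℤ) (s : Torus d) : ℂ :=
  monomial p s - 1 - Complex.I * (pairIm p s : ℂ)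

@[fun_prop] theorem continuous_lkIntegrand (p : Fin d → ℤ) : Continuous (lkIntegrand p) := by
  unfold lkIntegrand; fun_prop

theorem lkIntegrand_re (p : Fin d → ℤ) (s : Torus d) :
    (lkIntegrand p s).re = (monomial p s).re - 1 := by
  simp [lkIntegrand]

theorem exists_norm_lkIntegrand_le (p : Fin d → ℤ) :
    ∃ C, 0 ≤ C ∧ ∀ s, ‖lkIntegrand p s‖ ≤ C * gap s := by
  have hP := freqSize_nonneg p
  refine ⟨27 * freqSize p ^ 2 + 27 * freqSize p, by positivity, fun s => ?_⟩
  have h1 := norm_exp_sub_taylor_two_le (phase p s)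
  have h2 := abs_phase_sub_pairIm_le_sq p s
  have h3 := pow_le_pow_left₀ (abs_nonneg _) (abs_phase_le p s) 2
  have hq := Real.sq_sqrt (gap_nonneg s)
  rw [sq_abs] at h3
  have h4 : lkIntegrand p s =
      (Complex.exp (phase p s * Complex.I) - 1 - Complex.I * phase p s) +
        Complex.I * ((phase p s - pairIm p s : ℝ) : ℂ) := by
    rw [lkIntegrand, monomial_eq_exp]; push_cast; ring
  have h5 := norm_add_le (Complex.exp (phase p s * Complex.I) - 1 - Complex.I * phase p s)
    (Complex.I * ((phase p s - pairIm p s : ℝ) : ℂ))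
  rw [← h4, norm_mul, Complex.norm_I, one_mul, Complex.norm_real, Real.norm_eq_abs] at h5
  rw [hq] at h2
  have h6 : (freqSize p * (3 * √(gap s))) ^ 2 = 9 * freqSize p ^ 2 * gap s := by
    rw [mul_pow, mul_pow, hq]; ring
  rw [h6] at h3
  linarith

theorem exists_norm_lkIntegrand_add_le (p : Fin d → ℤ) :
    ∃ C, 0 ≤ C ∧ ∀ s, ‖lkIntegrand p s + (pairIm p s : ℂ) ^ 2 / 2‖ ≤ C * (gap s * √(gap s)) := by
  have hP := freqSize_nonneg p
  refine ⟨108 * freqSize p ^ 3 + 108 * freqSize p + 81 * freqSize p ^ 2, by positivity,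
    fun s => ?_⟩
  have h1 := norm_exp_sub_taylor_three_le (phase p s)
  have h2 := abs_phase_sub_pairIm_le_sq p s
  have h2' := abs_phase_sub_pairIm_le_cube p s
  have h3 := pow_le_pow_left₀ (abs_nonneg _) (abs_phase_le p s) 3
  have h3' := abs_phase_le p s
  have h3'' := abs_pairIm_le p s
  have hq := Real.sq_sqrt (gap_nonneg s)
  set q := √(gap s) with hqdef
  have hq0 : 0 ≤ q := Real.sqrt_nonneg _
  rw [← hq]
  set y := phase p s with hy
  set w := pairIm p s with hw
  set P := freqSize p with hPdef
  have h4 : lkIntegrand p s + (w : ℂ) ^ 2 / 2 =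
      (Complex.exp (y * Complex.I) - 1 - Complex.I * y + (y : ℂ) ^ 2 / 2) +
        Complex.I * ((y - w : ℝ) : ℂ) - (((y - w) * (y + w) / 2 : ℝ) : ℂ) := by
    rw [lkIntegrand, monomial_eq_exp]; push_cast; ring
  have h5 := norm_sub_le ((Complex.exp (y * Complex.I) - 1 - Complex.I * y + (y : ℂ) ^ 2 / 2) +
        Complex.I * ((y - w : ℝ) : ℂ)) (((y - w) * (y + w) / 2 : ℝ) : ℂ)
  have h6 := norm_add_le (Complex.exp (y * Complex.I) - 1 - Complex.I * y + (y : ℂ) ^ 2 / 2)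
        (Complex.I * ((y - w : ℝ) : ℂ))
  rw [norm_mul Complex.I, Complex.norm_I, one_mul, Complex.norm_real, Real.norm_eq_abs] at h6
  rw [← h4, Complex.norm_real, Real.norm_eq_abs, abs_div, abs_mul, abs_two] at h5
  have h7 : |y + w| ≤ 6 * P * q := by
    refine (abs_add_le _ _).trans ?_; linarith
  have h8 : |y - w| * |y + w| ≤ (P * (27 * q ^ 2)) * (6 * P * q) :=
    mul_le_mul h2 h7 (abs_nonneg _) (by positivity)
  nlinarith [h1, h2', h3, h5, h6, h8]

theorem one_sub_re_monomial_nonneg (p : Fin d → ℤ) (s : Torus d) :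
    0 ≤ 1 - (monomial p s).re := by
  rw [monomial_re]; linarith [Real.cos_le_one (phase p s)]

theorem exists_one_sub_re_monomial_le (p : Fin d → ℤ) :
    ∃ C, 0 ≤ C ∧ ∀ s, 1 - (monomial p s).re ≤ C * gap s := by
  obtain ⟨C, hC, h⟩ := exists_norm_lkIntegrand_le p
  refine ⟨C, hC, fun s => ?_⟩
  have := (Complex.abs_re_le_norm _).trans (h s)
  rw [lkIntegrand_re] at this
  linarith [abs_le.1 this]

theorem im_sq_le_gap (s : Torus d) (j : Fin d) : (s j : ℂ).im ^ 2 ≤ 2 * gap s := by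
  rw [circle_im_sq]
  have h1 := circle_re_le (s j)
  have h2 := neg_one_le_circle_re (s j)
  have h3 := one_sub_re_le_gap s j
  nlinarith

theorem abs_im_mul_im_le (s : Torus d) (j l : Fin d) :
    |(s j : ℂ).im * (s l : ℂ).im| ≤ 2 * gap s := by
  have h1 := im_sq_le_gap s j
  have h2 := im_sq_le_gap s l
  rw [abs_le]
  constructor <;> nlinarith [sq_nonneg ((s j : ℂ).im + (s l : ℂ).im),
    sq_nonneg ((s j : ℂ).im - (s l : ℂ).im)]

theorem norm_argVec_sq (s : Torus d) : ‖argVec s‖ ^ 2 = ∑ j, Complex.arg (s j : ℂ) ^ 2 := by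
  simp [argVec, EuclideanSpace.norm_sq_eq]

theorem gap_lt_of_mem_nhd {ε : ℝ} {s : Torus d} (h : s ∈ nhd d ε) : gap s < ε ^ 2 := by
  have h0 : ‖argVec s‖ < ε := h
  have hε : 0 < ε := (norm_nonneg _).trans_lt h0
  have h1 : ‖argVec s‖ ^ 2 < ε ^ 2 := by gcongr
  have h2 : gap s ≤ ‖argVec s‖ ^ 2 := by
    rw [norm_argVec_sq]
    refine Finset.sum_le_sum fun j _ => ?_
    rw [circle_re]
    have := one_sub_cos_le (Complex.arg (s j : ℂ))
    nlinarith [sq_nonneg (Complex.arg (s j : ℂ))]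
  linarith

theorem mem_nhd_of_gap_lt {ε : ℝ} (hε : 0 < ε) {s : Torus d} (h : gap s < ε ^ 2 / 5) :
    s ∈ nhd d ε := by
  have h2 : ‖argVec s‖ ^ 2 ≤ 5 * gap s := by
    rw [norm_argVec_sq, gap, Finset.mul_sum]
    exact Finset.sum_le_sum fun j _ => arg_sq_le (s j)
  exact lt_of_pow_lt_pow_left₀ 2 hε.le (by linarith)

theorem abs_arg_lt_of_mem_nhd {ε : ℝ} {s : Torus d} (h : s ∈ nhd d ε) (j : Fin d) :
    |Complex.arg (s j : ℂ)| < ε := by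
  have h0 : ‖argVec s‖ < ε := h
  refine lt_of_le_of_lt ?_ h0
  have := PiLp.norm_apply_le (argVec s) j
  simpa [argVec] using this

theorem measurableSet_nhd (ε : ℝ) : MeasurableSet (nhd d ε) := by
  have : nhd d ε = {s : Torus d | √(∑ j, Complex.arg (s j : ℂ) ^ 2) < ε} := by
    ext s
    rw [nhd, Set.mem_ofPred_eq, Set.mem_ofPred_eq, ← norm_argVec_sq, Real.sqrt_sq (norm_nonneg _)]
  rw [this]
  refine measurableSet_lt ?_ measurable_const
  have : ∀ j : Fin d, Measurable fun s : Torus d => Complex.arg (s j : ℂ) := fun j =>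
    Complex.measurable_arg.comp (Continuous.measurable (by fun_prop))
  fun_prop

theorem norm_circle_sub_one_sq (z : Circle) : ‖(z : ℂ) - 1‖ ^ 2 = 2 * (1 - (z : ℂ).re) := by
  rw [← Complex.normSq_eq_norm_sq, Complex.normSq_apply]
  have := circle_im_sq z
  simp only [Complex.sub_re, Complex.one_re, Complex.sub_im, Complex.one_im, sub_zero]
  nlinarith

theorem dist_sq_le (s : Torus d) : dist s 1 ^ 2 ≤ 2 * gap s := by
  have h0 : 0 ≤ 2 * gap s := by have := gap_nonneg s; positivity
  have : dist s 1 ≤ √(2 * gap s) := by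
    refine (dist_pi_le_iff (Real.sqrt_nonneg _)).2 fun j => Real.le_sqrt_of_sq_le ?_
    have : dist (s j) ((1 : Torus d) j) = ‖(s j : ℂ) - 1‖ := by
      rw [← dist_eq_norm]; rfl
    rw [this, norm_circle_sub_one_sq]
    have := one_sub_re_le_gap s j
    linarith
  calc _ ≤ √(2 * gap s) ^ 2 := by gcongr
    _ = _ := Real.sq_sqrt h0

theorem gap_le_dist_sq (s : Torus d) : gap s ≤ d * dist s 1 ^ 2 := by
  calc gap s ≤ ∑ _j : Fin d, dist s 1 ^ 2 := Finset.sum_le_sum fun j _ => by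
        have h1 : ‖(s j : ℂ) - 1‖ ≤ dist s 1 := by
          have h2 : ‖(s j : ℂ) - 1‖ = dist (s j) ((1 : Torus d) j) := by
            rw [← dist_eq_norm]; rfl
          rw [h2]; exact dist_le_pi_dist s 1 j
        have h3 := norm_circle_sub_one_sq (s j)
        have h4 := pow_le_pow_left₀ (norm_nonneg _) h1 2
        have h5 := circle_re_le (s j)
        linarith
    _ = _ := by simp

theorem gap_mul_le (s t : Torus d) : gap (s * t) ≤ 2 * gap s + 2 * gap t := by
  unfold gap
  rw [Finset.mul_sum, Finset.mul_sum, ← Finset.sum_add_distrib]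
  refine Finset.sum_le_sum fun j _ => ?_
  have h1 := norm_circle_sub_one_sq (s j * t j)
  have h2 := norm_circle_sub_one_sq (s j)
  have h3 := norm_circle_sub_one_sq (t j)
  have h4 : ‖((s j * t j : Circle) : ℂ) - 1‖ ≤ ‖(s j : ℂ) - 1‖ + ‖(t j : ℂ) - 1‖ := by
    have : ((s j * t j : Circle) : ℂ) - 1 = s j * ((t j : ℂ) - 1) + ((s j : ℂ) - 1) := by
      push_cast; ring
    rw [this]
    refine (norm_add_le _ _).trans ?_
    rw [norm_mul, Circle.norm_coe, one_mul, add_comm]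
  have h5 := pow_le_pow_left₀ (norm_nonneg _) h4 2
  rw [Pi.mul_apply]
  nlinarith [sq_nonneg (‖(s j : ℂ) - 1‖ - ‖(t j : ℂ) - 1‖)]

theorem gap_inv (s : Torus d) : gap s⁻¹ = gap s := by
  simp [gap]

/-- A continuous function that is `O(gap^{3/2})` has a continuous quotient by `gap`. -/
theorem continuous_div_gap {F : Torus d → ℂ} (hF : Continuous F) {C : ℝ}
    (h : ∀ s, ‖F s‖ ≤ C * (gap s * √(gap s))) :
    Continuous fun s => F s / (gap s : ℂ) := by
  rw [continuous_iff_continuousAt]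
  intro s
  by_cases hs : s = 1
  · subst hs
    have h0 : F 1 / (gap (1 : Torus d) : ℂ) = 0 := by simp
    rw [ContinuousAt, h0]
    refine squeeze_zero_norm (a := fun s => C * √(gap s)) (fun t => ?_) ?_
    · by_cases ht : t = 1
      · subst ht; simp
      · have hg := gap_pos ht
        rw [norm_div, Complex.norm_real, Real.norm_of_nonneg hg.le, div_le_iff₀ hg]
        linarith [h t]
    · have : Continuous fun s : Torus d => C * √(gap s) := by fun_prop
      simpa using this.tendsto 1
  · have hg := gap_pos hs
    refine ContinuousAt.div hF.continuousAt (by fun_prop) ?_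
    exact_mod_cast hg.ne'

/-! ### Integrability against Lévy measures -/

theorem norm_oneSubRe_le (s : Torus d) : ‖oneSubRe s‖ ≤ gap s := by
  refine abs_le_of_sq_le_sq' ?_ (gap_nonneg s) |>.2
  rw [EuclideanSpace.norm_sq_eq]
  simp only [oneSubRe, Real.norm_eq_abs, sq_abs]
  exact Finset.sum_sq_le_sq_sum_of_nonneg fun j _ => sub_nonneg.2 (circle_re_le _)

theorem gap_le_norm_oneSubRe (s : Torus d) : gap s ≤ d * ‖oneSubRe s‖ := by
  calc gap s ≤ ∑ _j : Fin d, ‖oneSubRe s‖ := Finset.sum_le_sum fun j _ => by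
        have := PiLp.norm_apply_le (oneSubRe s) j
        exact (le_abs_self _).trans this
    _ = _ := by simp

theorem integrable_of_norm_le_gap {E : Type*} [NormedAddCommGroup E] {τ : Measure (Torus d)}
    (hτ : Integrable gap τ) {F : Torus d → E} (hF : AEStronglyMeasurable F τ) {C : ℝ}
    (h : ∀ s, ‖F s‖ ≤ C * gap s) : Integrable F τ :=
  (hτ.const_mul C).mono' hF (Eventually.of_forall h)

theorem isLevyMeasure_iff {τ : Measure (Torus d)} :
    IsLevyMeasure τ ↔ τ {1} = 0 ∧ Integrable gap τ := by
  have hc : Continuous fun s : Torus d => ‖oneSubRe s‖ := by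
    unfold oneSubRe
    exact continuous_norm.comp ((PiLp.continuous_toLp 2 _).comp (by fun_prop))
  constructor
  · intro h
    refine ⟨h.one, (h.integrable.const_mul d).mono' (by fun_prop) ?_⟩
    refine Eventually.of_forall fun s => ?_
    rw [Real.norm_of_nonneg (gap_nonneg s)]
    exact gap_le_norm_oneSubRe s
  · rintro ⟨h1, h2⟩
    refine ⟨h1, h2.mono' hc.aestronglyMeasurable ?_⟩
    refine Eventually.of_forall fun s => ?_
    rw [norm_norm]
    exact norm_oneSubRe_le s

theorem IsLevyMeasure.integrable_gap {τ : Measure (Torus d)} (h : IsLevyMeasure τ) :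
    Integrable gap τ := (isLevyMeasure_iff.1 h).2

theorem integrable_of_continuous {E : Type*} [NormedAddCommGroup E]
    [SecondCountableTopologyEither (Torus d) E] {σ : Measure (Torus d)}
    [IsFiniteMeasure σ] {F : Torus d → E} (hF : Continuous F) : Integrable F σ :=
  hF.integrable_of_hasCompactSupport (HasCompactSupport.of_compactSpace F)

theorem integrable_lkIntegrand {τ : Measure (Torus d)} (h : Integrable gap τ) (p : Fin d → ℤ) :
    Integrable (lkIntegrand p) τ := by
  obtain ⟨C, _, hC⟩ := exists_norm_lkIntegrand_le p
  exact integrable_of_norm_le_gap h (by fun_prop) hC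

theorem integrable_one_sub_re {τ : Measure (Torus d)} (h : Integrable gap τ) (p : Fin d → ℤ) :
    Integrable (fun s => 1 - (monomial p s).re) τ := by
  obtain ⟨C, _, hC⟩ := exists_one_sub_re_monomial_le p
  refine integrable_of_norm_le_gap h (Continuous.aestronglyMeasurable (by fun_prop)) (C := C)
    fun s => ?_
  rw [Real.norm_of_nonneg (one_sub_re_monomial_nonneg p s)]
  exact hC s

theorem integrable_im_mul_im {τ : Measure (Torus d)} (h : Integrable gap τ) (j l : Fin d) :
    Integrable (fun s : Torus d => (s j : ℂ).im * (s l : ℂ).im) τ :=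
  integrable_of_norm_le_gap h (Continuous.aestronglyMeasurable (by fun_prop))
    fun s => abs_im_mul_im_le s j l

/-- The part of the weighted mass `∫ gap dτ` that lies close to the unit. -/
noncomputable def nearMass (τ : Measure (Torus d)) (r : ℝ) : ℝ :=
  ∫ s, {s : Torus d | gap s < r}.indicator gap s ∂τ

theorem measurableSet_gap_lt (r : ℝ) : MeasurableSet {s : Torus d | gap s < r} :=
  measurableSet_lt (by fun_prop) measurable_const

theorem integrable_near {τ : Measure (Torus d)} (h : Integrable gap τ) (r : ℝ) :
    Integrable ({s : Torus d | gap s < r}.indicator gap) τ :=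
  h.indicator (measurableSet_gap_lt r)

theorem abs_integral_le_nearMass {τ : Measure (Torus d)} (h : Integrable gap τ) {r C : ℝ}
    {F : Torus d → ℝ} (hF : ∀ s, |F s| ≤ C * {s : Torus d | gap s < r}.indicator gap s) :
    |∫ s, F s ∂τ| ≤ C * nearMass τ r := by
  rw [nearMass, ← integral_const_mul, ← Real.norm_eq_abs]
  exact norm_integral_le_of_norm_le ((integrable_near h r).const_mul C) (Eventually.of_forall hF)

theorem tendsto_nearMass {τ : Measure (Torus d)} (h : Integrable gap τ) :
    Tendsto (nearMass τ) (𝓝[>] 0) (𝓝 0) := by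
  suffices h0 : Tendsto (nearMass τ) (𝓝[>] 0) (𝓝 (∫ _ : Torus d, (0 : ℝ) ∂τ)) by
    simpa using h0
  unfold nearMass
  refine tendsto_integral_filter_of_dominated_convergence gap ?_ ?_ h ?_
  · exact Eventually.of_forall fun r => (integrable_near h r).aestronglyMeasurable
  · refine Eventually.of_forall fun r => Eventually.of_forall fun s => ?_
    refine (norm_indicator_le_norm_self _ _).trans ?_
    rw [Real.norm_of_nonneg (gap_nonneg s)]
  · refine Eventually.of_forall fun s => ?_
    by_cases hs : s = 1
    · subst hs
      refine tendsto_const_nhds.congr fun r => ?_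
      by_cases hr : (1 : Torus d) ∈ {s : Torus d | gap s < r}
      · rw [Set.indicator_of_mem hr, gap_one]
      · rw [Set.indicator_of_notMem hr]
    · have hg := gap_pos hs
      refine tendsto_const_nhds.congr' ?_
      filter_upwards [Ioo_mem_nhdsGT hg] with r hr
      rw [Set.indicator_of_notMem]
      exact not_lt.2 hr.2.le

/-! ### Compactness -/

/-- Bounded sequences of finite measures on a compact metrizable space have weakly convergent
subsequences. -/
theorem exists_subseq_tendsto_finiteMeasure {X : Type*} [Nonempty X] [TopologicalSpace X]
    [MeasurableSpace X]
    [BorelSpace X] [CompactSpace X] [TopologicalSpace.MetrizableSpace X]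
    (m : ℕ → FiniteMeasure X) {M : NNReal} (hM : ∀ n, (m n).mass ≤ M) :
    ∃ φ : ℕ → ℕ, StrictMono φ ∧ ∃ m₀ : FiniteMeasure X,
      Tendsto (fun n => m (φ n)) atTop (𝓝 m₀) := by
  have : TopologicalSpace.SeparableSpace X := by
    let _ := TopologicalSpace.metrizableSpaceMetric X
    infer_instance
  obtain ⟨P, φ, hφ, hP⟩ := CompactSpace.tendsto_subseq fun n => (m n).normalize
  obtain ⟨c, _, ψ, hψ, hc⟩ := isCompact_Icc.tendsto_subseq
    (x := fun n => (m (φ n)).mass) (s := Set.Icc 0 M) fun n => ⟨zero_le, hM _⟩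
  refine ⟨φ ∘ ψ, hφ.comp hψ, c • P.toFiniteMeasure, ?_⟩
  have h1 : Tendsto (fun n => ((m (φ (ψ n))).normalize).toFiniteMeasure) atTop
      (𝓝 P.toFiniteMeasure) :=
    (ProbabilityMeasure.toFiniteMeasure_continuous.tendsto P).comp (hP.comp hψ.tendsto_atTop)
  refine (hc.smul h1).congr fun n => ?_
  exact ((m (φ (ψ n))).self_eq_mass_smul_normalize).symm

/-- The finite measure `gap · σ`. -/
noncomputable def weighted (σ : Measure (Torus d)) : Measure (Torus d) :=
  σ.withDensity fun s => ((gap s).toNNReal : ENNReal)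

theorem measurable_gap_toNNReal : Measurable fun s : Torus d => (gap s).toNNReal :=
  Measurable.real_toNNReal (by fun_prop)

theorem integral_weighted (σ : Measure (Torus d)) (H : Torus d → ℂ) :
    ∫ s, H s ∂(weighted σ) = ∫ s, (gap s : ℂ) * H s ∂σ := by
  unfold weighted
  rw [integral_withDensity_eq_integral_smul measurable_gap_toNNReal]
  refine integral_congr_ae (Eventually.of_forall fun s => ?_)
  simp [NNReal.smul_def, gap_nonneg s]

theorem weighted_univ {σ : Measure (Torus d)} (h : Integrable gap σ) :
    weighted σ Set.univ = ENNReal.ofReal (∫ s, gap s ∂σ) := by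
  rw [weighted, withDensity_apply _ MeasurableSet.univ, Measure.restrict_univ,
    ofReal_integral_eq_lintegral_ofReal h (Eventually.of_forall gap_nonneg)]
  rfl

/-- The measure `1_{s ≠ 1} gap⁻¹ · m`. -/
noncomputable def unweighted (m : Measure (Torus d)) : Measure (Torus d) :=
  (m.restrict {1}ᶜ).withDensity fun s => ((gap s)⁻¹.toNNReal : ENNReal)

theorem measurable_gap_inv_toNNReal : Measurable fun s : Torus d => (gap s)⁻¹.toNNReal :=
  Measurable.real_toNNReal (Measurable.inv (by fun_prop))

theorem isLevyMeasure_unweighted (m : Measure (Torus d)) [IsFiniteMeasure m] :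
    IsLevyMeasure (unweighted m) := by
  rw [isLevyMeasure_iff]
  constructor
  · refine withDensity_absolutelyContinuous _ _ ?_
    rw [Measure.restrict_apply (measurableSet_singleton _)]
    simp
  · unfold unweighted
    rw [integrable_withDensity_iff_integrable_smul measurable_gap_inv_toNNReal]
    have h1 : Integrable (fun _ : Torus d => (1 : ℝ)) (m.restrict {1}ᶜ) := integrable_const _
    refine h1.congr ?_
    filter_upwards [ae_restrict_mem (measurableSet_singleton (1 : Torus d)).compl] with s hs
    have hg := gap_pos hs
    rw [NNReal.smul_def, Real.coe_toNNReal _ (inv_nonneg.2 hg.le), smul_eq_mul,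
      inv_mul_cancel₀ hg.ne']

theorem integral_unweighted (m : Measure (Torus d)) {H : Torus d → ℂ} (hH : H 1 = 0) :
    ∫ s, (gap s : ℂ) * H s ∂(unweighted m) = ∫ s, H s ∂m := by
  unfold unweighted
  rw [integral_withDensity_eq_integral_smul measurable_gap_inv_toNNReal]
  have h1 : ∫ s in {1}ᶜ, H s ∂m = ∫ s, H s ∂m := by
    refine setIntegral_eq_integral_of_forall_compl_eq_zero fun s hs => ?_
    have : s = 1 := by simpa using hs
    rw [this, hH]
  rw [← h1]
  refine setIntegral_congr_fun (measurableSet_singleton (1 : Torus d)).compl fun s hs => ?_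
  have hg := gap_pos hs
  have hg' : (gap s : ℂ) ≠ 0 := by exact_mod_cast hg.ne'
  simp only [NNReal.smul_def, Real.coe_toNNReal _ (inv_nonneg.2 hg.le), Complex.real_smul]
  push_cast
  rw [inv_mul_cancel_left₀ hg']

/-- `σ n` splits asymptotically into the Lévy measure `τ`, seen by test functions that vanish
faster than `gap` at the unit, and the covariance `A`, which is the second-order mass that
concentrates at the unit. -/
structure CondensedLimit (σ : ℕ → Measure (Torus d)) (τ : Measure (Torus d))
    (A : Matrix (Fin d) (Fin d) ℝ) : Prop where
  integrable (n : ℕ) : Integrable gap (σ n)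
  levy : IsLevyMeasure τ
  tendsto_weighted (H : Torus d → ℂ) : Continuous H → H 1 = 0 →
    Tendsto (fun n => ∫ s, (gap s : ℂ) * H s ∂(σ n)) atTop (𝓝 (∫ s, (gap s : ℂ) * H s ∂τ))
  tendsto_moment (j l : Fin d) :
    Tendsto (fun n => ∫ s : Torus d, (s j : ℂ).im * (s l : ℂ).im ∂(σ n)) atTop
      (𝓝 (A j l + ∫ s : Torus d, (s j : ℂ).im * (s l : ℂ).im ∂τ))

/-- Sequences of measures with bounded `gap`-mass are relatively compact for the convergence
`CondensedLimit`. -/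
theorem exists_subseq_condensedLimit {σ : ℕ → Measure (Torus d)}
    (hσ : ∀ n, Integrable gap (σ n)) {M : ℝ} (hM : ∀ n, ∫ s, gap s ∂(σ n) ≤ M) :
    ∃ φ : ℕ → ℕ, StrictMono φ ∧ ∃ τ A, CondensedLimit (fun n => σ (φ n)) τ A := by
  have hfin : ∀ n, IsFiniteMeasure (weighted (σ n)) := fun n =>
    ⟨by rw [weighted_univ (hσ n)]; exact ENNReal.ofReal_lt_top⟩
  obtain ⟨φ, hφ, m, hm⟩ := exists_subseq_tendsto_finiteMeasure
    (fun n => (⟨weighted (σ n), hfin n⟩ : FiniteMeasure (Torus d))) (M := M.toNNReal) (by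
      intro n
      have h1 : (weighted (σ n)) Set.univ ≤ ENNReal.ofReal M := by
        rw [weighted_univ (hσ n)]; exact ENNReal.ofReal_le_ofReal (hM n)
      have h2 := FiniteMeasure.ennreal_mass (μ := ⟨weighted (σ n), hfin n⟩)
      rw [← ENNReal.coe_le_coe, h2]
      exact h1)
  let K : ℕ → Fin d → Fin d → ℝ := fun n j l =>
    ∫ s : Torus d, (s j : ℂ).im * (s l : ℂ).im ∂(σ (φ n))
  have hK : ∀ n, K n ∈ Set.pi Set.univ fun _ : Fin d => Set.pi Set.univ fun _ : Fin d =>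
      Set.Icc (-(2 * M)) (2 * M) := by
    intro n j _ l _
    have h1 : |K n j l| ≤ ∫ s, 2 * gap s ∂(σ (φ n)) := by
      rw [← Real.norm_eq_abs]
      exact norm_integral_le_of_norm_le ((hσ _).const_mul 2)
        (Eventually.of_forall fun s => abs_im_mul_im_le s j l)
    rw [integral_const_mul] at h1
    have h2 := hM (φ n)
    exact abs_le.1 (by linarith)
  obtain ⟨K₀, _, ψ, hψ, hK₀⟩ := (isCompact_univ_pi fun _ : Fin d =>
    isCompact_univ_pi fun _ : Fin d => isCompact_Icc).tendsto_subseq hK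
  refine ⟨φ ∘ ψ, hφ.comp hψ, unweighted m, fun j l => K₀ j l -
    ∫ s : Torus d, (s j : ℂ).im * (s l : ℂ).im ∂(unweighted (m : Measure (Torus d))),
    fun _ => hσ _, isLevyMeasure_unweighted _, fun H hH hH1 => ?_, fun j l => ?_⟩
  · rw [integral_unweighted _ hH1]
    have h1 := (FiniteMeasure.tendsto_iff_forall_integral_rclike_tendsto ℂ).1 hm
      (BoundedContinuousFunction.mkOfCompact ⟨H, hH⟩)
    refine (h1.comp hψ.tendsto_atTop).congr fun n => ?_
    exact integral_weighted (σ (φ (ψ n))) H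
  · rw [sub_add_cancel]
    exact ((continuous_apply_apply j l).tendsto K₀).comp hK₀

namespace CondensedLimit

variable {σ : ℕ → Measure (Torus d)} {τ : Measure (Torus d)} {A : Matrix (Fin d) (Fin d) ℝ}

theorem tendsto_weighted_real (h : CondensedLimit σ τ A) {H : Torus d → ℝ} (hH : Continuous H)
    (hH1 : H 1 = 0) :
    Tendsto (fun n => ∫ s, gap s * H s ∂(σ n)) atTop (𝓝 (∫ s, gap s * H s ∂τ)) := by
  have h1 := h.tendsto_weighted (fun s => (H s : ℂ)) (by fun_prop) (by simp [hH1])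
  have h2 : ∀ μ : Measure (Torus d), ∫ s, (gap s : ℂ) * (H s : ℂ) ∂μ =
      ((∫ s, gap s * H s ∂μ : ℝ) : ℂ) := by
    intro μ
    rw [← integral_complex_ofReal]
    simp
  simp only [h2] at h1
  exact (Complex.continuous_re.tendsto _).comp h1

theorem symm (h : CondensedLimit σ τ A) (j l : Fin d) : A j l = A l j := by
  have h1 := h.tendsto_moment j l
  have h2 := h.tendsto_moment l j
  have h3 : ∀ μ : Measure (Torus d), ∫ s : Torus d, (s l : ℂ).im * (s j : ℂ).im ∂μ =
      ∫ s : Torus d, (s j : ℂ).im * (s l : ℂ).im ∂μ := fun μ =>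
    integral_congr_ae (Eventually.of_forall fun s => mul_comm _ _)
  simp only [h3] at h2
  exact add_right_cancel (tendsto_nhds_unique h1 h2)

end CondensedLimit

/-! ### Consequences of the splitting into a Lévy measure and a covariance -/

theorem integral_pairIm_sq {τ : Measure (Torus d)} (h : Integrable gap τ) (p : Fin d → ℤ) :
    ∫ s, pairIm p s ^ 2 ∂τ =
      ∑ j, ∑ l, (∫ s : Torus d, (s j : ℂ).im * (s l : ℂ).im ∂τ) * (p j : ℝ) * (p l : ℝ) := by
  have h1 : ∀ s : Torus d, pairIm p s ^ 2 =
      ∑ j, ∑ l, ((s j : ℂ).im * (s l : ℂ).im) * (p j : ℝ) * (p l : ℝ) := by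
    intro s
    rw [pairIm, sq, Finset.sum_mul_sum]
    exact Finset.sum_congr rfl fun j _ => Finset.sum_congr rfl fun l _ => by ring
  have hi := integrable_im_mul_im h
  simp only [h1]
  rw [integral_finsetSum _ fun j _ => integrable_finsetSum _ fun l _ =>
    ((hi j l).mul_const _).mul_const _]
  refine Finset.sum_congr rfl fun j _ => ?_
  rw [integral_finsetSum _ fun l _ => ((hi j l).mul_const _).mul_const _]
  refine Finset.sum_congr rfl fun l _ => ?_
  rw [integral_mul_const, integral_mul_const]

theorem integrable_pairIm_sq {τ : Measure (Torus d)} (h : Integrable gap τ) (p : Fin d → ℤ) :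
    Integrable (fun s => pairIm p s ^ 2) τ := by
  refine integrable_of_norm_le_gap h (Continuous.aestronglyMeasurable (by fun_prop))
    (C := (freqSize p * 3) ^ 2) fun s => ?_
  have h1 := pow_le_pow_left₀ (abs_nonneg _) (abs_pairIm_le p s) 2
  rw [← mul_assoc, mul_pow, Real.sq_sqrt (gap_nonneg s)] at h1
  rwa [norm_pow, Real.norm_eq_abs]

@[simp] theorem pairIm_one (p : Fin d → ℤ) : pairIm p (1 : Torus d) = 0 := by simp [pairIm]

@[simp] theorem lkIntegrand_one (p : Fin d → ℤ) : lkIntegrand p (1 : Torus d) = 0 := by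
  simp [lkIntegrand]

/-- The summand of third order in the expansion of the Lévy–Khintchine integrand, divided by
`gap`. -/
noncomputable def lkRemainder (p : Fin d → ℤ) (s : Torus d) : ℂ :=
  (lkIntegrand p s + (pairIm p s : ℂ) ^ 2 / 2) / (gap s : ℂ)

theorem lkIntegrand_eq (p : Fin d → ℤ) (s : Torus d) :
    lkIntegrand p s = (gap s : ℂ) * lkRemainder p s - ((pairIm p s ^ 2 : ℝ) : ℂ) / 2 := by
  by_cases hs : s = 1
  · subst hs; simp
  · have hg : (gap s : ℂ) ≠ 0 := by exact_mod_cast (gap_pos hs).ne'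
    rw [lkRemainder, mul_div_cancel₀ _ hg]; push_cast; ring

theorem continuous_lkRemainder (p : Fin d → ℤ) : Continuous (lkRemainder p) := by
  obtain ⟨C, _, hC⟩ := exists_norm_lkIntegrand_add_le p
  exact continuous_div_gap (by fun_prop) hC

theorem integral_lkIntegrand {τ : Measure (Torus d)} (h : Integrable gap τ) (p : Fin d → ℤ) :
    ∫ s, lkIntegrand p s ∂τ = ∫ s, (gap s : ℂ) * lkRemainder p s ∂τ -
      ((∫ s, pairIm p s ^ 2 ∂τ : ℝ) : ℂ) / 2 := by
  have h1 : Integrable (fun s => ((pairIm p s ^ 2 : ℝ) : ℂ)) τ :=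
    (integrable_pairIm_sq h p).ofReal
  have h2 : Integrable (fun s => (gap s : ℂ) * lkRemainder p s) τ := by
    refine ((integrable_lkIntegrand h p).add (h1.div_const 2)).congr
      (Eventually.of_forall fun s => ?_)
    simp only [Pi.add_apply, lkIntegrand_eq]
    simp
  simp only [lkIntegrand_eq]
  rw [integral_sub h2 (h1.div_const 2), integral_div]
  congr 2
  exact integral_ofReal

theorem CondensedLimit.tendsto_lkIntegral {σ : ℕ → Measure (Torus d)} {τ : Measure (Torus d)}
    {A : Matrix (Fin d) (Fin d) ℝ} (h : CondensedLimit σ τ A) (p : Fin d → ℤ) :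
    Tendsto (fun n => ∫ s, lkIntegrand p s ∂(σ n)) atTop
      (𝓝 (-(quadForm A p : ℂ) / 2 + ∫ s, lkIntegrand p s ∂τ)) := by
  have h1 := h.tendsto_weighted (lkRemainder p) (continuous_lkRemainder p) (by simp [lkRemainder])
  have h2 : Tendsto (fun n => ∫ s, pairIm p s ^ 2 ∂(σ n)) atTop
      (𝓝 (quadForm A p + ∫ s, pairIm p s ^ 2 ∂τ)) := by
    simp only [integral_pairIm_sq (h.integrable _), integral_pairIm_sq h.levy.integrable_gap]
    rw [quadForm, ← Finset.sum_add_distrib]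
    refine tendsto_finsetSum _ fun j _ => ?_
    rw [← Finset.sum_add_distrib]
    refine tendsto_finsetSum _ fun l _ => ?_
    rw [← add_mul, ← add_mul]
    exact ((h.tendsto_moment j l).mul_const _).mul_const _
  have h3 := (Complex.continuous_ofReal.tendsto _).comp h2
  have h4 := h1.sub (h3.div_const 2)
  simp only [integral_lkIntegrand (h.integrable _), integral_lkIntegrand h.levy.integrable_gap]
  refine (h4.congr fun n => rfl).trans_eq ?_
  congr 1; push_cast; ring

theorem AwayFromOne.exists_le_gap {B : Set (Torus d)} (h : AwayFromOne B) :
    ∃ c, 0 < c ∧ ∀ s ∈ B, c ≤ gap s := by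
  obtain ⟨r, hr, h⟩ := h
  refine ⟨r ^ 2 / 2, by positivity, fun s hs => ?_⟩
  have h1 := pow_le_pow_left₀ hr.le (h s hs) 2
  have h2 := dist_sq_le s
  linarith

theorem awayFromOne_of_le_gap {B : Set (Torus d)} {c : ℝ} (hc : 0 < c)
    (h : ∀ s ∈ B, c ≤ gap s) : AwayFromOne B := by
  refine ⟨√(c / (d + 1)), by positivity, fun s hs => ?_⟩
  refine Real.sqrt_le_iff.2 ⟨dist_nonneg, ?_⟩
  rw [div_le_iff₀ (by positivity)]
  have h1 := h s hs
  have h2 := gap_le_dist_sq s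
  nlinarith [sq_nonneg (dist s 1)]

theorem measure_lt_top_of_le_gap {τ : Measure (Torus d)} (h : Integrable gap τ) {B : Set (Torus d)}
    {c : ℝ} (hc : 0 < c) (hB : ∀ s ∈ B, c ≤ gap s) : τ B < ⊤ := by
  have h1 := h.measure_ge_lt_top hc
  exact (measure_mono hB).trans_lt h1

theorem IsLevyMeasure.mem_puncturedMeasures {τ : Measure (Torus d)} (h : IsLevyMeasure τ) :
    τ ∈ puncturedMeasures d := by
  refine ⟨h.one, fun B _ hB => ?_⟩
  obtain ⟨c, hc, hB⟩ := hB.exists_le_gap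
  exact measure_lt_top_of_le_gap h.integrable_gap hc hB

theorem integral_restrict_compl_one {σ : Measure (Torus d)} {F : Torus d → ℝ} (h : F 1 = 0) :
    ∫ s, F s ∂(σ.restrict {1}ᶜ) = ∫ s, F s ∂σ := by
  refine setIntegral_eq_integral_of_forall_compl_eq_zero fun s hs => ?_
  have : s = 1 := by simpa using hs
  rw [this, h]

theorem AwayFromOne.apply_one {F : Torus d → ℝ} (h : AwayFromOne (Function.support F)) :
    F 1 = 0 := by
  obtain ⟨r, hr, h⟩ := h
  by_contra h0
  have := h 1 h0
  rw [dist_self] at this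
  linarith

theorem CondensedLimit.vagueTendsto {σ : ℕ → Measure (Torus d)} {τ : Measure (Torus d)}
    {A : Matrix (Fin d) (Fin d) ℝ} (h : CondensedLimit σ τ A) :
    VagueTendsto (fun n => (σ n).restrict {1}ᶜ) τ := by
  intro f hf
  have hf1 := hf.apply_one
  obtain ⟨c, hc, hfc⟩ := hf.exists_le_gap
  simp only [integral_restrict_compl_one hf1]
  have hpos : ∀ s : Torus d, max c (gap s) ≠ 0 := fun s => (hc.trans_le (le_max_left _ _)).ne'
  have hcont : Continuous fun s => f s / max c (gap s) :=
    f.continuous.div (by fun_prop) hpos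
  have h1 := h.tendsto_weighted_real hcont (by simp [hf1])
  have h2 : ∀ s, gap s * (f s / max c (gap s)) = f s := by
    intro s
    by_cases hs : f s = 0
    · simp [hs]
    · have h3 := hfc s hs
      rw [max_eq_right h3]
      exact mul_div_cancel₀ _ (hc.trans_le h3).ne'
  simpa only [h2] using h1

/-- The second moments of `σ n` near the unit are asymptotically those of the covariance, up to
the mass that `gap · τ` puts near the unit. -/
theorem CondensedLimit.eventually_abs_truncMoment_sub_le {σ : ℕ → Measure (Torus d)}
    {τ : Measure (Torus d)} {A : Matrix (Fin d) (Fin d) ℝ} (h : CondensedLimit σ τ A)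
    {ε η : ℝ} (hε : 0 < ε) (hη : 0 < η) (j l : Fin d) :
    ∀ᶠ n in atTop, |truncMoment (σ n) ε j l - A j l| ≤ 4 * nearMass τ (2 * ε ^ 2) + η := by
  -- `1 - χ` is supported in `U_ε`, and `κ` is a continuous bump that equals one on `U_ε`.
  let f : Torus d → ℝ := fun s => (s j : ℂ).im * (s l : ℂ).im
  let a : ℝ := ε ^ 2 / 5
  have ha : 0 < a := by positivity
  have hpos : ∀ s : Torus d, 0 < max a (gap s) := fun s => ha.trans_le (le_max_left _ _)
  let χ : Torus d → ℝ := fun s => gap s / max a (gap s)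
  let κ : Torus d → ℝ := fun s => max 0 (min 1 (2 - gap s / ε ^ 2))
  have hf : Continuous f := by fun_prop
  have hχ : Continuous χ := Continuous.div (by fun_prop) (by fun_prop) fun s => (hpos s).ne'
  have hκ : Continuous κ := by fun_prop
  have hχ0 : ∀ s, 0 ≤ χ s := fun s => div_nonneg (gap_nonneg s) (hpos s).le
  have hχ1 : ∀ s, χ s ≤ 1 := fun s => (div_le_one (hpos s)).2 (le_max_right _ _)
  have hκ0 : ∀ s, 0 ≤ κ s := fun s => le_max_left _ _
  have hκ1 : ∀ s, κ s ≤ 1 := fun s => max_le zero_le_one (min_le_left _ _)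
  have hf_le : ∀ s, |f s| ≤ 2 * gap s := fun s => abs_im_mul_im_le s j l
  have hχ_out : ∀ s, a ≤ gap s → χ s = 1 := fun s hs => by
    simp only [χ]; rw [max_eq_right hs, div_self (ha.trans_le hs).ne']
  have hκ_in : ∀ s ∈ nhd d ε, κ s = 1 := fun s hs => by
    have h1 := gap_lt_of_mem_nhd hs
    have h2 : gap s / ε ^ 2 ≤ 1 := (div_le_one (by positivity)).2 h1.le
    simp only [κ]
    rw [min_eq_left (by linarith), max_eq_right zero_le_one]
  have hκ_out : ∀ s, 2 * ε ^ 2 ≤ gap s → κ s = 0 := fun s hs => by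
    have h2 : 2 ≤ gap s / ε ^ 2 := (le_div_iff₀ (by positivity)).2 hs
    simp only [κ]
    exact max_eq_left ((min_le_right _ _).trans (by linarith))
  have hout : ∀ s, s ∉ nhd d ε → a ≤ gap s := fun s hs => by
    by_contra h'
    exact hs (mem_nhd_of_gap_lt hε (not_le.1 h'))
  have hint : ∀ μ : Measure (Torus d), Integrable gap μ → Integrable f μ := fun μ hμ =>
    integrable_im_mul_im hμ j l
  have hintχ : ∀ μ : Measure (Torus d), Integrable gap μ → Integrable (fun s => χ s * f s) μ :=
    fun μ hμ => integrable_of_norm_le_gap hμ (Continuous.aestronglyMeasurable (by fun_prop))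
      (C := 2) fun s => by
        rw [Real.norm_eq_abs, abs_mul, abs_of_nonneg (hχ0 s)]
        nlinarith [hf_le s, hχ0 s, hχ1 s, abs_nonneg (f s)]
  have hintκ : ∀ μ : Measure (Torus d), Integrable gap μ →
      Integrable (fun s => gap s * (χ s * κ s)) μ :=
    fun μ hμ => integrable_of_norm_le_gap hμ (Continuous.aestronglyMeasurable (by fun_prop))
      (C := 1) fun s => by
        have h3 : χ s * κ s ≤ 1 := mul_le_one₀ (hχ1 s) (hκ0 s) (hκ1 s)
        have h4 : 0 ≤ χ s * κ s := mul_nonneg (hχ0 s) (hκ0 s)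
        rw [Real.norm_of_nonneg (mul_nonneg (gap_nonneg s) h4)]
        nlinarith [gap_nonneg s]
  have hkey : ∀ n, |truncMoment (σ n) ε j l - (∫ s, f s ∂(σ n) - ∫ s, χ s * f s ∂(σ n))| ≤
      2 * ∫ s, gap s * (χ s * κ s) ∂(σ n) := by
    intro n
    have hμ := h.integrable n
    have h1 : truncMoment (σ n) ε j l - (∫ s, f s ∂(σ n) - ∫ s, χ s * f s ∂(σ n)) =
        ∫ s, ((nhd d ε).indicator f s - (f s - χ s * f s)) ∂(σ n) := by
      rw [integral_sub, integral_sub (hint _ hμ) (hintχ _ hμ),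
        integral_indicator (measurableSet_nhd ε)]
      · rfl
      · exact (hint _ hμ).indicator (measurableSet_nhd ε)
      · exact (hint _ hμ).sub (hintχ _ hμ)
    rw [h1, ← integral_const_mul, ← Real.norm_eq_abs]
    refine norm_integral_le_of_norm_le ((hintκ _ hμ).const_mul 2) (Eventually.of_forall fun s => ?_)
    rw [Real.norm_eq_abs]
    by_cases hs : s ∈ nhd d ε
    · rw [Set.indicator_of_mem hs, hκ_in s hs, sub_sub_cancel, abs_mul, abs_of_nonneg (hχ0 s)]
      nlinarith [hf_le s, hχ0 s]
    · rw [Set.indicator_of_notMem hs, hχ_out s (hout s hs)]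
      simpa using mul_nonneg (gap_nonneg s) (hκ0 s)
  have hlim1 : Tendsto (fun n => ∫ s, χ s * f s ∂(σ n)) atTop (𝓝 (∫ s, χ s * f s ∂τ)) := by
    have h1 := h.tendsto_weighted_real (H := fun s => f s / max a (gap s))
      (hf.div (by fun_prop) fun s => (hpos s).ne') (by simp [f])
    refine (h1.congr fun n => ?_).trans_eq ?_
    · exact integral_congr_ae (Eventually.of_forall fun s => by simp only [χ]; ring)
    · congr 1
      exact integral_congr_ae (Eventually.of_forall fun s => by simp only [χ]; ring)
  have hlim2 := h.tendsto_weighted_real (H := fun s => χ s * κ s) (by fun_prop) (by simp [χ])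
  have hlim3 := h.tendsto_moment j l
  have hτ := h.levy.integrable_gap
  have hb1 : |∫ s, gap s * (χ s * κ s) ∂τ| ≤ 1 * nearMass τ (2 * ε ^ 2) := by
    refine abs_integral_le_nearMass hτ fun s => ?_
    have h3 : χ s * κ s ≤ 1 := mul_le_one₀ (hχ1 s) (hκ0 s) (hκ1 s)
    have h4 : 0 ≤ χ s * κ s := mul_nonneg (hχ0 s) (hκ0 s)
    rw [abs_of_nonneg (mul_nonneg (gap_nonneg s) h4)]
    by_cases hs : s ∈ {s : Torus d | gap s < 2 * ε ^ 2}
    · rw [Set.indicator_of_mem hs]; nlinarith [gap_nonneg s]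
    · rw [Set.indicator_of_notMem hs, hκ_out s (not_lt.1 hs)]; simp
  have hb2 : |∫ s, (f s - χ s * f s) ∂τ| ≤ 2 * nearMass τ (2 * ε ^ 2) := by
    refine abs_integral_le_nearMass hτ fun s => ?_
    by_cases hs : s ∈ {s : Torus d | gap s < 2 * ε ^ 2}
    · rw [Set.indicator_of_mem hs]
      have : f s - χ s * f s = (1 - χ s) * f s := by ring
      rw [this, abs_mul, abs_of_nonneg (sub_nonneg.2 (hχ1 s))]
      nlinarith [hf_le s, hχ0 s, hχ1 s, abs_nonneg (f s)]
    · have h3 : 2 * ε ^ 2 ≤ gap s := not_lt.1 hs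
      rw [Set.indicator_of_notMem hs, hχ_out s (by simp only [a]; nlinarith [sq_nonneg ε])]
      simp
  rw [integral_sub (hint _ hτ) (hintχ _ hτ)] at hb2
  have e1 := (Metric.tendsto_nhds.1 hlim1) (η / 6) (by positivity)
  have e2 := (Metric.tendsto_nhds.1 hlim2) (η / 6) (by positivity)
  have e3 := (Metric.tendsto_nhds.1 hlim3) (η / 6) (by positivity)
  filter_upwards [e1, e2, e3] with n h1 h2 h3
  rw [Real.dist_eq] at h1 h2 h3
  have h4 := hkey n
  simp only [f] at *
  rw [abs_lt] at h1 h2 h3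
  rw [abs_le] at h4 hb1 hb2 ⊢
  constructor <;> linarith [h1.1, h1.2, h2.1, h2.2, h3.1, h3.2, h4.1, h4.2, hb1.1, hb1.2,
    hb2.1, hb2.2]

/-- Limits of vaguely convergent sequences are unique. -/
theorem vague_limit_unique {σ : ℕ → Measure (Torus d)} {τ τ' : Measure (Torus d)}
    (hτ : τ ∈ puncturedMeasures d) (hτ' : τ' ∈ puncturedMeasures d)
    (h : VagueTendsto σ τ) (h' : VagueTendsto σ τ') : τ = τ' := by
  let r : ℕ → ℝ := fun n => 1 / (n + 1)
  have hr : ∀ n, 0 < r n := fun n => by positivity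
  let S : ℕ → Set (Torus d) := fun n => {s | r n < gap s}
  have hS : ∀ n, MeasurableSet (S n) := fun n => measurableSet_lt measurable_const (by fun_prop)
  have hSaway : ∀ n, AwayFromOne (S n) := fun n =>
    awayFromOne_of_le_gap (hr n) fun s hs => le_of_lt hs
  let w : ℕ → Torus d → NNReal := fun n s => (gap s - r n).toNNReal
  have hw : ∀ n, Measurable (w n) := fun n => Measurable.real_toNNReal (by fun_prop)
  have hw_le : ∀ n s, (w n s : ENNReal) ≤ (S n).indicator (fun _ => ENNReal.ofReal (2 * d)) s := by
    intro n s
    by_cases hs : s ∈ S n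
    · rw [Set.indicator_of_mem hs]
      exact ENNReal.ofReal_le_ofReal (by linarith [gap_le s, hr n])
    · have : w n s = 0 := Real.toNNReal_of_nonpos (by
        have : gap s ≤ r n := not_lt.1 hs
        linarith)
      simp [this]
  have hfin : ∀ n, ∀ μ ∈ puncturedMeasures d,
      IsFiniteMeasure (μ.withDensity fun s => (w n s : ENNReal)) := by
    intro n μ hμ
    refine isFiniteMeasure_withDensity (ne_of_lt ?_)
    refine (lintegral_mono (hw_le n)).trans_lt ?_
    rw [lintegral_indicator_const (hS n)]
    exact ENNReal.mul_lt_top ENNReal.ofReal_lt_top (hμ.2 _ (hS n) (hSaway n))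
  have hdens : ∀ n, (τ.withDensity fun s => (w n s : ENNReal)) =
      τ'.withDensity fun s => (w n s : ENNReal) := by
    intro n
    have := hfin n τ hτ
    have := hfin n τ' hτ'
    refine ext_of_forall_integral_eq_of_IsFiniteMeasure fun F => ?_
    rw [integral_withDensity_eq_integral_smul (hw n), integral_withDensity_eq_integral_smul (hw n)]
    let G : BoundedContinuousFunction (Torus d) ℝ :=
      BoundedContinuousFunction.mkOfCompact ⟨fun s => (w n s : ℝ) * F s, by
        simp only [w, Real.coe_toNNReal']; fun_prop⟩
    have hG : AwayFromOne (Function.support G) := by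
      refine awayFromOne_of_le_gap (hr n) fun s hs => ?_
      by_contra h0
      refine hs ?_
      have : w n s = 0 := Real.toNNReal_of_nonpos (by linarith [not_le.1 h0])
      simp [G, this]
    exact tendsto_nhds_unique (h G hG) (h' G hG)
  have hrestr : ∀ n, ∀ μ : Measure (Torus d), μ.restrict (S n) =
      ((μ.withDensity fun s => (w n s : ENNReal)).restrict (S n)).withDensity
        (fun s => (w n s : ENNReal)⁻¹) := by
    intro n μ
    rw [restrict_withDensity (hS n)]
    refine (withDensity_inv_same (measurable_coe_nnreal_ennreal.comp (hw n)) ?_ ?_).symm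
    · filter_upwards [ae_restrict_mem (hS n)] with s hs
      have : 0 < w n s := Real.toNNReal_pos.2 (sub_pos.2 hs)
      exact ENNReal.coe_ne_zero.2 this.ne'
    · exact Eventually.of_forall fun s => ENNReal.coe_ne_top
  have hcover : (⋃ i : Option ℕ, i.elim ({1} : Set (Torus d)) S) = Set.univ := by
    refine Set.eq_univ_of_forall fun s => Set.mem_iUnion.2 ?_
    by_cases hs : s = 1
    · exact ⟨none, hs⟩
    · obtain ⟨n, hn⟩ := exists_nat_one_div_lt (gap_pos hs)
      exact ⟨some n, hn⟩
  rw [Measure.ext_iff_of_iUnion_eq_univ hcover]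
  rintro (_ | n)
  · change τ.restrict {1} = τ'.restrict {1}
    rw [Measure.restrict_eq_zero.2 hτ.1, Measure.restrict_eq_zero.2 hτ'.1]
  · change τ.restrict (S n) = τ'.restrict (S n)
    rw [hrestr n τ, hrestr n τ', hdens n]

/-! ### What the moduli of the characteristic function determine -/

theorem norm_levyKhintchine (γ : Torus d) (A : Matrix (Fin d) (Fin d) ℝ) {τ : Measure (Torus d)}
    (h : Integrable gap τ) (p : Fin d → ℤ) :
    ‖levyKhintchine γ A τ p‖ =
      Real.exp (-(quadForm A p / 2 + ∫ s, (1 - (monomial p s).re) ∂τ)) := by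
  rw [levyKhintchine, norm_mul, norm_monomial, one_mul, Complex.norm_exp]
  congr 1
  have h1 : (∫ s, lkIntegrand p s ∂τ).re = ∫ s, ((monomial p s).re - 1) ∂τ := by
    rw [← Complex.reCLM_apply, ← ContinuousLinearMap.integral_comp_comm _
      (integrable_lkIntegrand h p)]
    simp only [Complex.reCLM_apply, lkIntegrand_re]
  have h2 : ∫ s, (1 - (monomial p s).re) ∂τ = -∫ s, ((monomial p s).re - 1) ∂τ := by
    rw [← integral_neg]; simp
  have h3 : (-(quadForm A p : ℂ) / 2).re = -(quadForm A p / 2) := by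
    have : (-(quadForm A p : ℂ) / 2) = ((-(quadForm A p / 2) : ℝ) : ℂ) := by push_cast; ring
    rw [this, Complex.ofReal_re]
  rw [Complex.add_re, h3, h2]
  change _ + (∫ s, lkIntegrand p s ∂τ).re = _
  rw [h1]; ring

/-- A Lévy measure contributes less than quadratically to the exponent. -/
theorem tendsto_integral_one_sub_re_div_sq {τ : Measure (Torus d)} (h : Integrable gap τ)
    (p : Fin d → ℤ) :
    Tendsto (fun n : ℕ => (∫ s, (1 - (monomial (n • p) s).re) ∂τ) / (n : ℝ) ^ 2) atTop (𝓝 0) := by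
  simp only [← integral_div]
  suffices h0 : Tendsto (fun n : ℕ => ∫ s, (1 - (monomial (n • p) s).re) / (n : ℝ) ^ 2 ∂τ) atTop
      (𝓝 (∫ _ : Torus d, (0 : ℝ) ∂τ)) by simpa using h0
  refine tendsto_integral_of_dominated_convergence
    (fun s => (freqSize p * 3) ^ 2 * gap s) (fun n => ?_) (h.const_mul _) (fun n => ?_) ?_
  · exact Continuous.aestronglyMeasurable (by fun_prop)
  · refine Eventually.of_forall fun s => ?_
    rw [Real.norm_of_nonneg (div_nonneg (one_sub_re_monomial_nonneg _ _) (by positivity)),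
      monomial_nsmul]
    have h1 := one_sub_cos_le (n * phase p s)
    have h2 := pow_le_pow_left₀ (abs_nonneg _) (abs_phase_le p s) 2
    rw [← mul_assoc, mul_pow _ √_, Real.sq_sqrt (gap_nonneg s), sq_abs] at h2
    rcases Nat.eq_zero_or_pos n with rfl | hn
    · have h3 : 0 ≤ phase p s ^ 2 := sq_nonneg _
      simp; linarith
    · have hn' : (0 : ℝ) < (n : ℝ) ^ 2 := by positivity
      rw [div_le_iff₀ hn']
      nlinarith [sq_nonneg (phase p s)]
  · refine Eventually.of_forall fun s => ?_
    refine squeeze_zero (g := fun n : ℕ => 2 * ((1 : ℝ) / (n : ℝ)) ^ 2)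
      (fun n => div_nonneg (one_sub_re_monomial_nonneg _ _) (by positivity)) (fun n => ?_) ?_
    · rw [monomial_nsmul, one_div, inv_pow, div_eq_mul_inv]
      have := Real.neg_one_le_cos (n * phase p s)
      exact mul_le_mul_of_nonneg_right (by linarith) (by positivity)
    · have := (tendsto_one_div_atTop_nhds_zero_nat (𝕜 := ℝ)).pow 2
      simpa using this.const_mul 2

theorem quadForm_nsmul (A : Matrix (Fin d) (Fin d) ℝ) (p : Fin d → ℤ) (n : ℕ) :
    quadForm A (n • p) = (n : ℝ) ^ 2 * quadForm A p := by
  simp only [quadForm, Finset.mul_sum, Pi.smul_apply, nsmul_eq_mul]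
  refine Finset.sum_congr rfl fun j _ => Finset.sum_congr rfl fun l _ => ?_
  push_cast; ring

theorem quadForm_single (A : Matrix (Fin d) (Fin d) ℝ) (j : Fin d) :
    quadForm A (Pi.single j 1) = A j j := by
  simp [quadForm, Pi.single_apply]

theorem quadForm_single_add_single {A : Matrix (Fin d) (Fin d) ℝ} (hA : ∀ j l, A j l = A l j)
    (j l : Fin d) :
    quadForm A (Pi.single j 1 + Pi.single l 1) = A j j + 2 * A j l + A l l := by
  simp only [quadForm, Pi.add_apply, Pi.single_apply, Int.cast_add, mul_add, add_mul,
    Finset.sum_add_distrib]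
  simp
  linarith [hA j l]

/-- A Gaussian covariance is determined by the moduli of the characteristic function: it is the
quadratic growth rate of the exponent. -/
theorem covariance_unique {A A' : Matrix (Fin d) (Fin d) ℝ} (hA : ∀ j l, A j l = A l j)
    (hA' : ∀ j l, A' j l = A' l j) {τ τ' : Measure (Torus d)} (h : Integrable gap τ)
    (h' : Integrable gap τ')
    (heq : ∀ p, quadForm A p / 2 + ∫ s, (1 - (monomial p s).re) ∂τ =
      quadForm A' p / 2 + ∫ s, (1 - (monomial p s).re) ∂τ') : A = A' := by
  have hq : ∀ p, quadForm A p = quadForm A' p := by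
    intro p
    have h1 := (tendsto_integral_one_sub_re_div_sq h p).const_add (quadForm A p / 2)
    have h2 := (tendsto_integral_one_sub_re_div_sq h' p).const_add (quadForm A' p / 2)
    have h3 : (fun n : ℕ => quadForm A p / 2 +
        (∫ s, (1 - (monomial (n • p) s).re) ∂τ) / (n : ℝ) ^ 2) =ᶠ[atTop]
        (fun n : ℕ => quadForm A' p / 2 +
        (∫ s, (1 - (monomial (n • p) s).re) ∂τ') / (n : ℝ) ^ 2) := by
      filter_upwards [eventually_gt_atTop 0] with n hn
      have hn' : (n : ℝ) ^ 2 ≠ 0 := by positivity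
      have h4 := heq (n • p)
      rw [quadForm_nsmul, quadForm_nsmul] at h4
      field_simp at h4 ⊢
      linarith
    have := tendsto_nhds_unique (h1.congr' h3) h2
    linarith
  ext j l
  have h1 := hq (Pi.single j 1 + Pi.single l 1)
  rw [quadForm_single_add_single hA, quadForm_single_add_single hA'] at h1
  have h2 := hq (Pi.single j 1)
  have h3 := hq (Pi.single l 1)
  rw [quadForm_single, quadForm_single] at h2 h3
  linarith

theorem gap_le_sum_one_sub_re {n : ℕ} (hn : 0 < n) {s : Torus d}
    (hs : gap s < 1 / (n : ℝ) ^ 2) :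
    gap s ≤ ∑ j : Fin d, 5 / 2 *
      ((1 - (monomial (n • Pi.single j (1 : ℤ)) s).re) / (n : ℝ) ^ 2) := by
  have hn' : (0 : ℝ) < n := by exact_mod_cast hn
  refine Finset.sum_le_sum fun j _ => ?_
  have hph : phase (Pi.single j (1 : ℤ)) s = Complex.arg (s j : ℂ) := by
    simp [phase, Pi.single_apply]
  rw [monomial_nsmul, hph, circle_re]
  set x := Complex.arg (s j : ℂ) with hx
  have h1 : |(n : ℝ) * x| ≤ Real.pi := by
    have h2 := abs_arg_le s j
    have h3 : √(gap s) ≤ 1 / n := by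
      rw [Real.sqrt_le_left (by positivity)]
      rw [div_pow, one_pow]; exact hs.le
    rw [abs_mul, abs_of_pos hn']
    calc (n : ℝ) * |x| ≤ n * (3 * (1 / n)) := by
          refine mul_le_mul_of_nonneg_left ?_ hn'.le; linarith
      _ = 3 := by field_simp
      _ ≤ Real.pi := Real.pi_gt_three.le
  have h4 := sq_le_five_mul h1
  have h5 := one_sub_cos_le x
  rw [← mul_div_assoc, le_div_iff₀ (by positivity)]
  nlinarith [sq_nonneg x, sq_nonneg (n : ℝ)]

/-- Measures whose exponents have the same real part as that of `ρ` carry uniformly little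
weighted mass near the unit. This controls the whole class of Lévy measures of a distribution at
once. -/
theorem exists_forall_nearMass_le {ρ : Measure (Torus d)} (h : Integrable gap ρ) {η : ℝ}
    (hη : 0 < η) : ∃ r, 0 < r ∧ ∀ τ : Measure (Torus d), Integrable gap τ →
      (∀ p, ∫ s, (1 - (monomial p s).re) ∂τ = ∫ s, (1 - (monomial p s).re) ∂ρ) →
      ∀ r' ≤ r, nearMass τ r' ≤ η := by
  have h1 : Tendsto (fun n : ℕ => ∑ j : Fin d, 5 / 2 *
      ((∫ s, (1 - (monomial (n • Pi.single j (1 : ℤ)) s).re) ∂ρ) / (n : ℝ) ^ 2)) atTop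
      (𝓝 (∑ _j : Fin d, 5 / 2 * 0)) :=
    tendsto_finsetSum _ fun j _ => (tendsto_integral_one_sub_re_div_sq h _).const_mul _
  simp only [mul_zero, Finset.sum_const_zero] at h1
  obtain ⟨n, hn, hn0⟩ := ((h1.eventually (gt_mem_nhds hη)).and (eventually_gt_atTop 0)).exists
  refine ⟨1 / (n : ℝ) ^ 2, by positivity, fun τ hτ heq r' hr' => ?_⟩
  refine le_trans ?_ hn.le
  simp only [← heq]
  simp only [← integral_div, ← integral_const_mul]
  have hi : ∀ j : Fin d, Integrable (fun s => 5 / 2 *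
      ((1 - (monomial (n • Pi.single j (1 : ℤ)) s).re) / (n : ℝ) ^ 2)) τ := fun j =>
    ((integrable_one_sub_re hτ _).div_const _).const_mul _
  rw [← integral_finsetSum _ fun j _ => hi j]
  refine integral_mono (integrable_near hτ r') (integrable_finsetSum _ fun j _ => hi j) fun s => ?_
  by_cases hs : s ∈ {s : Torus d | gap s < r'}
  · rw [Set.indicator_of_mem hs]
    exact gap_le_sum_one_sub_re hn0 (lt_of_lt_of_le hs hr')
  · rw [Set.indicator_of_notMem hs]
    exact Finset.sum_nonneg fun j _ => mul_nonneg (by norm_num)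
      (div_nonneg (one_sub_re_monomial_nonneg _ _) (by positivity))

/-! ### Characteristic functions on the torus -/

theorem integrable_monomial (μ : Measure (Torus d)) [IsFiniteMeasure μ] (p : Fin d → ℤ) :
    Integrable (monomial p) μ := integrable_of_continuous (continuous_monomial p)

theorem charFn_dirac (ξ : Torus d) (p : Fin d → ℤ) :
    charFn (Measure.dirac ξ) p = monomial p ξ := by
  rw [charFn, integral_dirac]

theorem charFn_conv (μ ν : ProbabilityMeasure (Torus d)) (p : Fin d → ℤ) :
    charFn (conv μ ν : Measure (Torus d)) p = charFn (μ : Measure (Torus d)) p * charFn ν p := by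
  have : (conv μ ν : Measure (Torus d)) = (μ : Measure (Torus d)).mconv (ν : Measure (Torus d)) :=
    rfl
  unfold charFn
  rw [this, integral_mconv (integrable_monomial _ p)]
  simp only [monomial_mul, integral_const_mul, integral_mul_const]

theorem charFn_foldl_conv (l : List (ProbabilityMeasure (Torus d)))
    (μ : ProbabilityMeasure (Torus d)) (p : Fin d → ℤ) :
    charFn (l.foldl conv μ : ProbabilityMeasure (Torus d)) p =
      charFn μ p * (l.map fun ν : ProbabilityMeasure (Torus d) => charFn (ν : Measure (Torus d)) p).prod := by
  induction l generalizing μ with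
  | nil => simp
  | cons ν l ih => rw [List.foldl_cons, ih, charFn_conv, List.map_cons, List.prod_cons, mul_assoc]

theorem charFn_rowConv (ξ : Torus d) {m : ℕ} (ν : Fin m → ProbabilityMeasure (Torus d))
    (p : Fin d → ℤ) :
    charFn (rowConv ξ ν : Measure (Torus d)) p =
      monomial p ξ * ∏ i, charFn (ν i : Measure (Torus d)) p := by
  rw [rowConv, charFn_foldl_conv, List.map_ofFn, List.prod_ofFn]
  congr 1
  exact charFn_dirac ξ p

/-- The monomial `s ↦ s^p` as a bounded continuous function. -/
noncomputable def monomialBCF (p : Fin d → ℤ) : BoundedContinuousFunction (Torus d) ℂ :=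
  BoundedContinuousFunction.mkOfCompact ⟨monomial p, continuous_monomial p⟩

@[simp] theorem monomialBCF_apply (p : Fin d → ℤ) (s : Torus d) :
    monomialBCF p s = monomial p s := rfl

/-- The star algebra of trigonometric polynomials on the torus. -/
noncomputable def trigPolynomials (d : ℕ) :
    StarSubalgebra ℂ (BoundedContinuousFunction (Torus d) ℂ) where
  toSubalgebra := (Submodule.span ℂ (Set.range (monomialBCF (d := d)))).toSubalgebra
    (Submodule.subset_span ⟨0, by ext s; simp [monomial_zero]⟩)
    (fun x y hx hy => by
      have h := Submodule.mul_mem_mul hx hy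
      rw [Submodule.span_mul_span] at h
      refine Submodule.span_mono ?_ h
      rintro _ ⟨_, ⟨p, rfl⟩, _, ⟨q, rfl⟩, rfl⟩
      exact ⟨p + q, by ext s; simp [monomial_add]⟩)
  star_mem' := by
    intro x hx
    change x ∈ Submodule.span ℂ _ at hx
    change star x ∈ Submodule.span ℂ _
    induction hx using Submodule.span_induction with
    | mem x hx =>
      obtain ⟨p, rfl⟩ := hx
      exact Submodule.subset_span ⟨-p, by ext s; simp [monomial_neg]⟩
    | zero => simp
    | add x y _ _ hx hy => rw [star_add]; exact Submodule.add_mem _ hx hy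
    | smul a x _ hx => rw [star_smul]; exact Submodule.smul_mem _ _ hx

/-- A finite measure on the torus is determined by its characteristic function. -/
theorem measure_ext_of_charFn {μ ν : Measure (Torus d)} [IsFiniteMeasure μ] [IsFiniteMeasure ν]
    (h : ∀ p, charFn μ p = charFn ν p) : μ = ν := by
  refine ext_of_forall_mem_subalgebra_integral_eq_of_polish (𝕜 := ℂ) (A := trigPolynomials d) ?_ ?_
  · intro s t hst
    obtain ⟨j, hj⟩ := Function.ne_iff.1 hst
    refine ⟨monomial (Pi.single j 1), ?_, ?_⟩
    · refine ⟨(monomialBCF (Pi.single j 1)).toContinuousMap, ⟨monomialBCF (Pi.single j 1),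
        Submodule.subset_span ⟨_, rfl⟩, rfl⟩, rfl⟩
    · rw [monomial_single, monomial_single, zpow_one, zpow_one]
      exact fun h => hj (Circle.ext h)
  · intro g hg
    change g ∈ Submodule.span ℂ _ at hg
    have hint : ∀ (x : BoundedContinuousFunction (Torus d) ℂ) (κ : Measure (Torus d))
        [IsFiniteMeasure κ], Integrable (fun s => x s) κ := fun x κ _ =>
      integrable_of_continuous x.continuous
    induction hg using Submodule.span_induction with
    | mem x hx => obtain ⟨p, rfl⟩ := hx; exact h p
    | zero => simp
    | add x y _ _ hx hy =>
      simp only [BoundedContinuousFunction.add_apply]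
      rw [integral_add (hint x μ) (hint y μ), integral_add (hint x ν) (hint y ν), hx, hy]
    | smul a x _ hx =>
      simp only [BoundedContinuousFunction.smul_apply]
      rw [integral_smul, integral_smul, hx]

theorem tendsto_charFn {μ : ℕ → ProbabilityMeasure (Torus d)} {μ₀ : ProbabilityMeasure (Torus d)}
    (h : Tendsto μ atTop (𝓝 μ₀)) (p : Fin d → ℤ) :
    Tendsto (fun n => charFn (μ n : Measure (Torus d)) p) atTop (𝓝 (charFn μ₀ p)) :=
  (ProbabilityMeasure.tendsto_iff_forall_integral_rclike_tendsto ℂ).1 h (monomialBCF p)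

theorem probabilityMeasure_ext_of_charFn {μ ν : ProbabilityMeasure (Torus d)}
    (h : ∀ p, charFn (μ : Measure (Torus d)) p = charFn ν p) : μ = ν :=
  Subtype.ext (measure_ext_of_charFn (μ := (μ : Measure (Torus d))) (ν := (ν : Measure (Torus d))) h)

/-- Lévy's continuity theorem on the torus. -/
theorem tendsto_iff_charFn {μ : ℕ → ProbabilityMeasure (Torus d)}
    {μ₀ : ProbabilityMeasure (Torus d)} :
    Tendsto μ atTop (𝓝 μ₀) ↔
      ∀ p, Tendsto (fun n => charFn (μ n : Measure (Torus d)) p) atTop (𝓝 (charFn μ₀ p)) := by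
  refine ⟨fun h p => tendsto_charFn h p, fun h => tendsto_of_subseq_tendsto fun ns hns => ?_⟩
  obtain ⟨P, φ, hφ, hP⟩ := CompactSpace.tendsto_subseq fun n => μ (ns n)
  have : P = μ₀ := probabilityMeasure_ext_of_charFn fun p =>
    tendsto_nhds_unique (tendsto_charFn hP p) ((h p).comp (hns.comp hφ.tendsto_atTop))
  exact ⟨φ, this ▸ hP⟩

theorem monomial_exp (p : Fin d → ℤ) (t : Fin d → ℝ) :
    monomial p (fun j => Circle.exp (t j)) =
      Complex.exp (Complex.I * ((∑ j, (p j : ℝ) * t j : ℝ) : ℂ)) := by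
  simp only [monomial, Circle.coe_exp, ← Complex.exp_int_mul, ← Complex.exp_sum]
  congr 1
  push_cast
  rw [Finset.mul_sum]
  exact Finset.sum_congr rfl fun j _ => by ring

theorem integral_lkIntegrand_of_finite (μ : Measure (Torus d)) [IsFiniteMeasure μ]
    (p : Fin d → ℤ) :
    ∫ s, lkIntegrand p s ∂μ = ∫ s, (monomial p s - 1) ∂μ -
      Complex.I * ((∑ j, (p j : ℝ) * ∫ s : Torus d, (s j : ℂ).im ∂μ : ℝ) : ℂ) := by
  have i1 : Integrable (fun s => monomial p s - 1) μ :=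
    (integrable_monomial μ p).sub (integrable_const _)
  have i2 : Integrable (fun s => Complex.I * ((pairIm p s : ℝ) : ℂ)) μ :=
    integrable_of_continuous (by fun_prop)
  have h3 : ∫ s, ((pairIm p s : ℝ) : ℂ) ∂μ = ((∫ s, pairIm p s ∂μ : ℝ) : ℂ) := integral_ofReal
  have h4 : ∫ s, pairIm p s ∂μ = ∑ j, (p j : ℝ) * ∫ s : Torus d, (s j : ℂ).im ∂μ := by
    unfold pairIm
    rw [integral_finsetSum _ fun j _ => integrable_of_continuous (by fun_prop)]
    simp only [integral_const_mul]
  unfold lkIntegrand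
  rw [integral_sub i1 i2, integral_const_mul, h3, h4]

/-! ### Existence of the distribution with a given Lévy triplet -/

/-- `ψ` is the characteristic function of a probability measure. -/
def IsCharFn (ψ : (Fin d → ℤ) → ℂ) : Prop :=
  ∃ ν : ProbabilityMeasure (Torus d), ∀ p, charFn (ν : Measure (Torus d)) p = ψ p

namespace IsCharFn

theorem of_tendsto {ψ : ℕ → (Fin d → ℤ) → ℂ} {ψ₀ : (Fin d → ℤ) → ℂ} (h : ∀ n, IsCharFn (ψ n))
    (hlim : ∀ p, Tendsto (fun n => ψ n p) atTop (𝓝 (ψ₀ p))) : IsCharFn ψ₀ := by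
  choose ν hν using h
  obtain ⟨P, φ, hφ, hP⟩ := CompactSpace.tendsto_subseq ν
  refine ⟨P, fun p => tendsto_nhds_unique (tendsto_charFn hP p) ?_⟩
  simp only [Function.comp_apply, hν]
  exact (hlim p).comp hφ.tendsto_atTop

theorem mul {ψ ψ' : (Fin d → ℤ) → ℂ} (h : IsCharFn ψ) (h' : IsCharFn ψ') :
    IsCharFn fun p => ψ p * ψ' p := by
  obtain ⟨ν, hν⟩ := h
  obtain ⟨ν', hν'⟩ := h'
  exact ⟨conv ν ν', fun p => by rw [charFn_conv, hν, hν']⟩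

theorem of_monomial (ξ : Torus d) : IsCharFn fun p => monomial p ξ :=
  ⟨diracProb ξ, fun p => charFn_dirac ξ p⟩

theorem one : IsCharFn (d := d) fun _ => 1 := by simpa using of_monomial (1 : Torus d)

theorem pow {ψ : (Fin d → ℤ) → ℂ} (h : IsCharFn ψ) (n : ℕ) : IsCharFn fun p => ψ p ^ n := by
  induction n with
  | zero => simpa using one
  | succ n ih => simpa only [pow_succ] using ih.mul h

theorem prod {ι : Type*} (t : Finset ι) {ψ : ι → (Fin d → ℤ) → ℂ} (h : ∀ i, IsCharFn (ψ i)) :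
    IsCharFn fun p => ∏ i ∈ t, ψ i p := by
  classical
  induction t using Finset.induction_on with
  | empty => simpa using one
  | insert i t hi ih => simpa only [Finset.prod_insert hi] using (h i).mul ih

theorem mix {ψ : (Fin d → ℤ) → ℂ} (h : IsCharFn ψ) {t : ℝ} (h0 : 0 ≤ t) (h1 : t ≤ 1) :
    IsCharFn fun p => 1 + t * (ψ p - 1) := by
  obtain ⟨ν, hν⟩ := h
  let m : Measure (Torus d) :=
    ENNReal.ofReal (1 - t) • Measure.dirac 1 + ENNReal.ofReal t • (ν : Measure (Torus d))
  have hm : IsProbabilityMeasure m := ⟨by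
    simp only [m, Measure.add_apply, Measure.smul_apply, measure_univ, smul_eq_mul, mul_one]
    rw [← ENNReal.ofReal_add (by linarith) h0]; simp⟩
  refine ⟨⟨m, hm⟩, fun p => ?_⟩
  change charFn m p = _
  have i1 : Integrable (monomial p) (ENNReal.ofReal (1 - t) • Measure.dirac (1 : Torus d)) :=
    (integrable_monomial _ p).smul_measure ENNReal.ofReal_ne_top
  have i2 : Integrable (monomial p) (ENNReal.ofReal t • (ν : Measure (Torus d))) :=
    (integrable_monomial _ p).smul_measure ENNReal.ofReal_ne_top
  have h2 := hν p
  unfold charFn at h2 ⊢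
  rw [integral_add_measure i1 i2, integral_smul_measure, integral_smul_measure, integral_dirac, h2,
    ENNReal.toReal_ofReal (by linarith), ENNReal.toReal_ofReal h0, monomial_one]
  simp only [Complex.real_smul]
  push_cast; ring

/-- Compound Poisson distributions. -/
theorem exp_mul_sub_one {ψ : (Fin d → ℤ) → ℂ} (h : IsCharFn ψ) {c : ℝ} (hc : 0 ≤ c) :
    IsCharFn fun p => Complex.exp (c * (ψ p - 1)) := by
  -- The `n`-fold power of the mixture with weight `c / n`; the weight is capped at one for small
  -- `n`.
  refine of_tendsto (ψ := fun n p => (1 + (min 1 (c / n) : ℝ) * (ψ p - 1)) ^ n)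
    (fun n => (h.mix (le_min zero_le_one (by positivity)) (min_le_left _ _)).pow n) fun p => ?_
  refine (Complex.tendsto_one_add_div_pow_exp (c * (ψ p - 1))).congr' ?_
  filter_upwards [eventually_ge_atTop (max 1 ⌈c⌉₊)] with n hn
  have hn1 : (1 : ℝ) ≤ n := by exact_mod_cast (le_max_left _ _).trans hn
  have hn2 : c ≤ n := (Nat.le_ceil c).trans (by exact_mod_cast (le_max_right _ _).trans hn)
  rw [min_eq_right ((div_le_one (by linarith)).2 hn2)]
  push_cast
  ring

theorem exp_integral_sub_one (σ : Measure (Torus d)) [IsFiniteMeasure σ] :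
    IsCharFn fun p => Complex.exp (∫ s, (monomial p s - 1) ∂σ) := by
  by_cases hσ : σ = 0
  · subst hσ; simpa using one
  have : NeZero σ := ⟨hσ⟩
  let ν : ProbabilityMeasure (Torus d) := ⟨(σ Set.univ)⁻¹ • σ, inferInstance⟩
  have h : IsCharFn fun p => charFn (ν : Measure (Torus d)) p := ⟨ν, fun p => rfl⟩
  convert h.exp_mul_sub_one (c := σ.real Set.univ) measureReal_nonneg using 3 with p
  have h1 : charFn (ν : Measure (Torus d)) p =
      (σ.real Set.univ : ℂ)⁻¹ * ∫ s, monomial p s ∂σ := by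
    change ∫ s, monomial p s ∂((σ Set.univ)⁻¹ • σ) = _
    rw [integral_smul_measure, Complex.real_smul, ENNReal.toReal_inv]
    push_cast; rfl
  have h2 : (σ.real Set.univ : ℂ) ≠ 0 := by
    have : σ.real Set.univ ≠ 0 := by simpa [measureReal_def, ENNReal.toReal_eq_zero_iff] using hσ
    exact_mod_cast this
  rw [integral_sub (integrable_monomial σ p) (integrable_const _), h1, mul_sub,
    mul_inv_cancel_left₀ h2]
  simp

/-- Gaussian laws with a covariance of rank one. -/
theorem exp_neg_sq (v : Fin d → ℝ) :
    IsCharFn fun p : Fin d → ℤ => Complex.exp (((-(∑ j, v j * (p j : ℝ)) ^ 2 / 2 : ℝ)) : ℂ) := by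
  -- Symmetric two-point jumps of size `v / n` at rate `n²`.
  let ξ : ℝ → Torus d := fun t j => Circle.exp (t * v j)
  have hξ : ∀ t p, monomial p (ξ t) =
      Complex.exp ((t * ∑ j, v j * (p j : ℝ) : ℝ) * Complex.I) := by
    intro t p
    simp only [monomial, ξ, Circle.coe_exp, ← Complex.exp_int_mul, ← Complex.exp_sum]
    congr 1
    push_cast
    rw [Finset.mul_sum, Finset.sum_mul]
    exact Finset.sum_congr rfl fun j _ => by ring
  let σ : ℕ → Measure (Torus d) := fun n =>
    (ENNReal.ofReal ((n : ℝ) ^ 2 / 2)) • (Measure.dirac (ξ (1 / n)) + Measure.dirac (ξ (-(1 / n))))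
  have hσfin : ∀ n, IsFiniteMeasure (σ n) := fun n => Measure.smul_finite _ ENNReal.ofReal_ne_top
  refine of_tendsto (fun n => exp_integral_sub_one (σ n)) fun p => ?_
  refine (Complex.continuous_exp.tendsto _).comp ?_
  set y := ∑ j, v j * (p j : ℝ) with hy
  have h1 : ∀ n, ∫ s, (monomial p s - 1) ∂(σ n) =
      (((n : ℝ) ^ 2 * (Real.cos (1 / n * y) - 1) : ℝ) : ℂ) := by
    intro n
    have i : ∀ t, Integrable (fun s => monomial p s - 1) (Measure.dirac (ξ t)) := fun t =>
      (integrable_monomial _ p).sub (integrable_const _)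
    simp only [σ]
    rw [integral_smul_measure, integral_add_measure (i _) (i _), integral_dirac, integral_dirac,
      hξ, hξ, ENNReal.toReal_ofReal (by positivity), ← hy, Complex.real_smul]
    rw [neg_mul, Complex.ofReal_neg]
    have h2 := Complex.two_cos (((1 / n * y : ℝ)) : ℂ)
    push_cast at h2 ⊢
    linear_combination (-(n : ℂ) ^ 2 / 2) * h2
  simp only [h1]
  refine (Complex.continuous_ofReal.tendsto _).comp ?_
  rw [← tendsto_sub_nhds_zero_iff]
  refine squeeze_zero_norm' (a := fun n : ℕ => 4 * |y| ^ 3 * (1 / (n : ℝ))) ?_ ?_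
  · filter_upwards [eventually_gt_atTop 0] with n hn
    have hn' : (0 : ℝ) < n := by exact_mod_cast hn
    have h3 := (Complex.abs_re_le_norm _).trans (norm_exp_sub_taylor_three_le (1 / n * y))
    have h4 : (Complex.exp ((1 / n * y : ℝ) * Complex.I) - 1 - Complex.I * ((1 / n * y : ℝ) : ℂ) +
        ((1 / n * y : ℝ) : ℂ) ^ 2 / 2).re = Real.cos (1 / n * y) - 1 + (1 / n * y) ^ 2 / 2 := by
      have h5 : (((1 / n * y : ℝ) : ℂ) ^ 2 / 2).re = (1 / n * y) ^ 2 / 2 := by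
        have : ((1 / n * y : ℝ) : ℂ) ^ 2 / 2 = (((1 / n * y) ^ 2 / 2 : ℝ) : ℂ) := by push_cast; ring
        rw [this, Complex.ofReal_re]
      rw [Complex.add_re, h5, Complex.sub_re, Complex.sub_re, Complex.exp_ofReal_mul_I_re]
      simp
    rw [h4] at h3
    have h6 : (n : ℝ) ^ 2 * (Real.cos (1 / n * y) - 1) - -y ^ 2 / 2 =
        (n : ℝ) ^ 2 * (Real.cos (1 / n * y) - 1 + (1 / n * y) ^ 2 / 2) := by
      field_simp; ring
    rw [h6, Real.norm_eq_abs, abs_mul, abs_of_nonneg (by positivity : (0 : ℝ) ≤ (n : ℝ) ^ 2)]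
    calc (n : ℝ) ^ 2 * _ ≤ (n : ℝ) ^ 2 * (4 * |1 / n * y| ^ 3) :=
          mul_le_mul_of_nonneg_left h3 (by positivity)
      _ = 4 * |y| ^ 3 * (1 / (n : ℝ)) := by
          rw [abs_mul, abs_of_nonneg (by positivity : (0 : ℝ) ≤ 1 / n)]; field_simp
  · simpa using (tendsto_one_div_atTop_nhds_zero_nat (𝕜 := ℝ)).const_mul (4 * |y| ^ 3)

theorem gaussian {A : Matrix (Fin d) (Fin d) ℝ} (hA : A.PosSemidef) :
    IsCharFn fun p => Complex.exp (-(quadForm A p : ℂ) / 2) := by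
  obtain ⟨m, v, rfl⟩ := Matrix.posSemidef_iff_eq_sum_vecMulVec.1 hA
  have h := prod Finset.univ fun i => exp_neg_sq (v i)
  convert h using 2 with p
  rw [← Complex.exp_sum]
  congr 1
  have : quadForm (∑ i, Matrix.vecMulVec (v i) (star (v i))) p =
      ∑ i, (∑ j, v i j * (p j : ℝ)) ^ 2 := by
    simp only [quadForm, Matrix.sum_apply, Matrix.vecMulVec_apply, star_trivial, sq,
      Finset.mul_sum, Finset.sum_mul]
    rw [Finset.sum_comm_cycle]
    refine Finset.sum_congr rfl fun i _ => Finset.sum_congr rfl fun j _ =>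
      Finset.sum_congr rfl fun l _ => by ring
  rw [this]
  push_cast
  rw [neg_div, Finset.sum_div, ← Finset.sum_neg_distrib]
  exact Finset.sum_congr rfl fun i _ => by ring

theorem exp_integral_lkIntegrand_of_finite (σ : Measure (Torus d)) [IsFiniteMeasure σ] :
    IsCharFn fun p => Complex.exp (∫ s, lkIntegrand p s ∂σ) := by
  convert (exp_integral_sub_one σ).mul
    (of_monomial (fun j => Circle.exp (-∫ s : Torus d, (s j : ℂ).im ∂σ))) using 2 with p
  rw [integral_lkIntegrand_of_finite, monomial_exp, ← Complex.exp_add]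
  congr 1
  simp [sub_eq_add_neg, Finset.sum_neg_distrib]

theorem exp_integral_lkIntegrand {ρ : Measure (Torus d)} (h : Integrable gap ρ) :
    IsCharFn fun p => Complex.exp (∫ s, lkIntegrand p s ∂ρ) := by
  let S : ℕ → Set (Torus d) := fun n => {s | 1 / ((n : ℝ) + 1) ≤ gap s}
  have hS : ∀ n, MeasurableSet (S n) := fun n => measurableSet_le measurable_const (by fun_prop)
  have hfin : ∀ n, IsFiniteMeasure (ρ.restrict (S n)) := fun n =>
    ⟨by rw [Measure.restrict_apply_univ]
        exact measure_lt_top_of_le_gap h (by positivity : (0 : ℝ) < 1 / ((n : ℝ) + 1))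
          fun s hs => hs⟩
  refine of_tendsto (fun n => exp_integral_lkIntegrand_of_finite (ρ.restrict (S n))) fun p => ?_
  refine (Complex.continuous_exp.tendsto _).comp ?_
  have hi := integrable_lkIntegrand h p
  simp only [← integral_indicator (hS _)]
  refine tendsto_integral_of_dominated_convergence (fun s => ‖lkIntegrand p s‖)
    (fun n => (hi.indicator (hS n)).aestronglyMeasurable) hi.norm
    (fun n => Eventually.of_forall fun s => norm_indicator_le_norm_self _ _)
    (Eventually.of_forall fun s => ?_)
  by_cases hs : s = 1
  · subst hs
    refine tendsto_const_nhds.congr fun n => ?_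
    by_cases hn : (1 : Torus d) ∈ S n
    · rw [Set.indicator_of_mem hn]
    · rw [Set.indicator_of_notMem hn, lkIntegrand_one]
  · refine tendsto_const_nhds.congr' ?_
    filter_upwards [tendsto_one_div_add_atTop_nhds_zero_nat.eventually (gt_mem_nhds (gap_pos hs))]
      with n hn
    rw [Set.indicator_of_mem]
    exact le_of_lt hn

end IsCharFn

theorem isCharFn_levyKhintchine {γ : Torus d} {A : Matrix (Fin d) (Fin d) ℝ}
    {ρ : Measure (Torus d)} (hT : IsLevyTriplet γ A ρ) : IsCharFn (levyKhintchine γ A ρ) := by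
  have h := (IsCharFn.of_monomial γ).mul ((IsCharFn.gaussian hT.posSemidef).mul
    (IsCharFn.exp_integral_lkIntegrand hT.levy.integrable_gap))
  convert h using 2 with p
  rw [← Complex.exp_add]
  rfl

theorem existsUnique_hasLevyTriplet {γ : Torus d} {A : Matrix (Fin d) (Fin d) ℝ}
    {ρ : Measure (Torus d)} (hT : IsLevyTriplet γ A ρ) :
    ∃! ν : ProbabilityMeasure (Torus d), HasLevyTriplet ν γ A ρ := by
  obtain ⟨ν, hν⟩ := isCharFn_levyKhintchine hT
  refine ⟨ν, ⟨hT, hν⟩, fun ν' hν' => probabilityMeasure_ext_of_charFn fun p => ?_⟩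
  rw [hν, hν'.charFn_eq]

/-! ### Centered laws -/

theorem monomial_prod {ι : Type*} (t : Finset ι) (p : Fin d → ℤ) (s : ι → Torus d) :
    monomial p (∏ i ∈ t, s i) = ∏ i ∈ t, monomial p (s i) := by
  classical
  induction t using Finset.induction_on with
  | empty => simp
  | insert i t hi ih => rw [Finset.prod_insert hi, Finset.prod_insert hi, monomial_mul, ih]

theorem norm_charFn_le_one (μ : Measure (Torus d)) [IsProbabilityMeasure μ] (p : Fin d → ℤ) :
    ‖charFn μ p‖ ≤ 1 := by
  refine (norm_integral_le_integral_norm _).trans ?_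
  simp

theorem charFn_sub_one_eq (μ : Measure (Torus d)) [IsProbabilityMeasure μ] (p : Fin d → ℤ) :
    charFn μ p - 1 = ∫ s, lkIntegrand p s ∂μ +
      Complex.I * ((∑ j, (p j : ℝ) * ∫ s : Torus d, (s j : ℂ).im ∂μ : ℝ) : ℂ) := by
  rw [integral_lkIntegrand_of_finite, sub_add_cancel,
    integral_sub (integrable_monomial μ p) (integrable_const _)]
  simp [charFn]

/-- A law is centered with constant `C` when its mean displacement is at most `C` times its
second-order size. -/
def IsCentered (C : ℝ) (μ : Measure (Torus d)) : Prop :=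
  ∀ j, |∫ s : Torus d, (s j : ℂ).im ∂μ| ≤ C * ∫ s, gap s ∂μ

theorem integral_gap_nonneg (μ : Measure (Torus d)) : 0 ≤ ∫ s, gap s ∂μ :=
  integral_nonneg gap_nonneg

theorem integrable_gap_of_finite (μ : Measure (Torus d)) [IsFiniteMeasure μ] : Integrable gap μ :=
  integrable_of_continuous continuous_gap

theorem exists_norm_charFn_sub_one_le (C : ℝ) (p : Fin d → ℤ) :
    ∃ K, 0 < K ∧ ∀ μ : Measure (Torus d), IsProbabilityMeasure μ → IsCentered C μ →
      ‖charFn μ p - 1‖ ≤ K * ∫ s, gap s ∂μ := by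
  obtain ⟨B, hB, h⟩ := exists_norm_lkIntegrand_le p
  have hP := freqSize_nonneg p
  refine ⟨B + freqSize p * |C| + 1, by positivity, fun μ _ hC => ?_⟩
  have ha := integral_gap_nonneg μ
  rw [charFn_sub_one_eq]
  have h1 : ‖∫ s, lkIntegrand p s ∂μ‖ ≤ B * ∫ s, gap s ∂μ := by
    rw [← integral_const_mul]
    exact norm_integral_le_of_norm_le ((integrable_gap_of_finite μ).const_mul B)
      (Eventually.of_forall h)
  have h2 : |∑ j, (p j : ℝ) * ∫ s : Torus d, (s j : ℂ).im ∂μ| ≤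
      freqSize p * (|C| * ∫ s, gap s ∂μ) :=
    abs_sum_mul_le p fun j => (hC j).trans (mul_le_mul_of_nonneg_right (le_abs_self C) ha)
  refine (norm_add_le _ _).trans ?_
  rw [norm_mul, Complex.norm_I, one_mul, Complex.norm_real, Real.norm_eq_abs]
  nlinarith

/-- For centered laws near the unit, the second-order size is controlled by the moduli of the
first characteristic coefficients. -/
theorem exists_integral_gap_le (d : ℕ) (C : ℝ) :
    ∃ δ, 0 < δ ∧ ∀ μ : Measure (Torus d), IsProbabilityMeasure μ → IsCentered C μ →
      ∫ s, gap s ∂μ ≤ δ →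
      ∫ s, gap s ∂μ ≤ ∑ j, (1 - ‖charFn μ (Pi.single j 1)‖ ^ 2) := by
  refine ⟨1 / (d * (1 + C ^ 2) + 1), by positivity, fun μ _ hC hδ => ?_⟩
  set a := ∫ s, gap s ∂μ with ha
  have ha0 : 0 ≤ a := integral_gap_nonneg μ
  have ire : ∀ j, Integrable (fun s : Torus d => 1 - (s j : ℂ).re) μ := fun j =>
    integrable_of_continuous (by fun_prop)
  have hsum : a = ∑ j, ∫ s : Torus d, (1 - (s j : ℂ).re) ∂μ := by
    rw [ha, ← integral_finsetSum _ fun j _ => ire j]; rfl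
  have hr0 : ∀ j, 0 ≤ ∫ s : Torus d, (1 - (s j : ℂ).re) ∂μ := fun j =>
    integral_nonneg fun s => sub_nonneg.2 (circle_re_le _)
  have hra : ∀ j, ∫ s : Torus d, (1 - (s j : ℂ).re) ∂μ ≤ a := fun j => by
    rw [hsum]
    exact Finset.single_le_sum (f := fun j => ∫ s : Torus d, (1 - (s j : ℂ).re) ∂μ)
      (fun i _ => hr0 i) (Finset.mem_univ j)
  have hterm : ∀ j, 2 * ∫ s : Torus d, (1 - (s j : ℂ).re) ∂μ - (1 + C ^ 2) * a ^ 2 ≤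
      1 - ‖charFn μ (Pi.single j 1)‖ ^ 2 := by
    intro j
    have hint : Integrable (fun s : Torus d => (s j : ℂ)) μ :=
      integrable_of_continuous (by fun_prop)
    have h1 : charFn μ (Pi.single j 1) = ∫ s : Torus d, (s j : ℂ) ∂μ := by
      simp only [charFn, monomial_single, zpow_one]
    have h2 : (∫ s : Torus d, (s j : ℂ) ∂μ).re = 1 - ∫ s : Torus d, (1 - (s j : ℂ).re) ∂μ := by
      rw [integral_sub (integrable_const _) (integrable_of_continuous (by fun_prop)),
        ← Complex.reCLM_apply, ← ContinuousLinearMap.integral_comp_comm _ hint]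
      simp
    have h3 : (∫ s : Torus d, (s j : ℂ) ∂μ).im = ∫ s : Torus d, (s j : ℂ).im ∂μ := by
      rw [← Complex.imCLM_apply, ← ContinuousLinearMap.integral_comp_comm _ hint]
      simp
    have h4 := pow_le_pow_left₀ (abs_nonneg _) (hC j) 2
    rw [sq_abs, mul_pow] at h4
    rw [h1, ← Complex.normSq_eq_norm_sq, Complex.normSq_apply, h2, h3]
    have h5 := hr0 j
    have h6 := hra j
    nlinarith
  calc a ≤ 2 * a - d * ((1 + C ^ 2) * a ^ 2) := by
        rw [le_div_iff₀ (by positivity)] at hδ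
        nlinarith
    _ = ∑ j, (2 * ∫ s : Torus d, (1 - (s j : ℂ).re) ∂μ - (1 + C ^ 2) * a ^ 2) := by
        rw [Finset.sum_sub_distrib, ← Finset.mul_sum, ← hsum]; simp
    _ ≤ _ := Finset.sum_le_sum fun j _ => hterm j

/-! ### The centering of an infinitesimal law -/

/-- The truncated mean argument that defines the centering. -/
noncomputable def meanArg (θ : ℝ) (ν : ProbabilityMeasure (Torus d)) (j : Fin d) : ℝ :=
  ∫ s in nhd d θ, Complex.arg (s j : ℂ) ∂(ν : Measure (Torus d))

theorem measurable_arg_apply (j : Fin d) : Measurable fun s : Torus d => Complex.arg (s j : ℂ) :=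
  Complex.measurable_arg.comp (Continuous.measurable (by fun_prop))

theorem integrable_arg (ν : ProbabilityMeasure (Torus d)) (j : Fin d) :
    Integrable (fun s : Torus d => Complex.arg (s j : ℂ)) (ν : Measure (Torus d)) := by
  refine (integrable_const Real.pi).mono' (measurable_arg_apply j).aestronglyMeasurable ?_
  exact Eventually.of_forall fun s => Complex.abs_arg_le_pi _

theorem abs_meanArg_le {θ lam : ℝ} (hlam : 0 < lam) (ν : ProbabilityMeasure (Torus d)) (j : Fin d) :
    |meanArg θ ν j| ≤ lam + 5 / lam * ∫ s, gap s ∂(ν : Measure (Torus d)) := by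
  have hg := integrable_gap_of_finite (ν : Measure (Torus d))
  have h1 : ∫ s, (lam + 5 / lam * gap s) ∂(ν : Measure (Torus d)) =
      lam + 5 / lam * ∫ s, gap s ∂(ν : Measure (Torus d)) := by
    rw [integral_add (integrable_const _) (hg.const_mul _), integral_const_mul]; simp
  rw [← h1, meanArg, ← integral_indicator (measurableSet_nhd θ), ← Real.norm_eq_abs]
  refine norm_integral_le_of_norm_le ((integrable_const _).add (hg.const_mul _))
    (Eventually.of_forall fun s => ?_)
  refine (norm_indicator_le_norm_self _ _).trans ?_
  rw [Real.norm_eq_abs]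
  have h2 := arg_sq_le (s j)
  have h3 := one_sub_re_le_gap s j
  have h4 : |Complex.arg (s j : ℂ)| * lam ≤ lam * lam + 5 * gap s := by
    nlinarith [sq_nonneg (|Complex.arg (s j : ℂ)| - lam), sq_abs (Complex.arg (s j : ℂ)),
      abs_nonneg (Complex.arg (s j : ℂ))]
  have h5 : lam + 5 / lam * gap s = (lam * lam + 5 * gap s) / lam := by field_simp
  rw [h5, le_div_iff₀ hlam]
  exact h4

theorem abs_meanArg_le_radius {θ : ℝ} (hθ : 0 < θ) (ν : ProbabilityMeasure (Torus d))
    (j : Fin d) : |meanArg θ ν j| ≤ θ := by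
  rw [meanArg, ← integral_indicator (measurableSet_nhd θ), ← Real.norm_eq_abs]
  refine (norm_integral_le_of_norm_le (integrable_const θ) (Eventually.of_forall fun s => ?_)).trans
    (by simp)
  by_cases hs : s ∈ nhd d θ
  · rw [Set.indicator_of_mem hs]
    exact (abs_arg_lt_of_mem_nhd hs j).le
  · rw [Set.indicator_of_notMem hs]; simpa using hθ.le

theorem gap_exp_le {t : Fin d → ℝ} {c : ℝ} (h : ∀ j, |t j| ≤ c) :
    gap (fun j => Circle.exp (t j)) ≤ d * c ^ 2 / 2 := by
  calc gap (fun j => Circle.exp (t j)) ≤ ∑ _j : Fin d, c ^ 2 / 2 :=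
        Finset.sum_le_sum fun j _ => by
          rw [Circle.coe_exp, Complex.exp_ofReal_mul_I_re]
          have h1 := one_sub_cos_le (t j)
          have h2 := pow_le_pow_left₀ (abs_nonneg _) (h j) 2
          rw [sq_abs] at h2
          linarith
    _ = _ := by simp; ring

theorem measurable_rotation (b : Torus d) : Measurable fun s : Torus d => b * s :=
  (continuous_const.mul continuous_id).measurable

instance isProbabilityMeasure_rotated (θ : ℝ) (ν : ProbabilityMeasure (Torus d)) :
    IsProbabilityMeasure (rotated θ ν) :=
  Measure.isProbabilityMeasure_map (measurable_rotation _).aemeasurable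

instance isFiniteMeasure_rowMeasure (θ : ℝ) {m : ℕ} (ν : Fin m → ProbabilityMeasure (Torus d)) :
    IsFiniteMeasure (rowMeasure θ ν) := by
  unfold rowMeasure; infer_instance

theorem integral_rotated {E : Type*} [NormedAddCommGroup E] [NormedSpace ℝ E]
    [SecondCountableTopologyEither (Torus d) E] (θ : ℝ)
    (ν : ProbabilityMeasure (Torus d)) {F : Torus d → E} (hF : Continuous F) :
    ∫ s, F s ∂(rotated θ ν) =
      ∫ s, F ((centering θ ν)⁻¹ * s) ∂(ν : Measure (Torus d)) :=
  integral_map (measurable_rotation _).aemeasurable hF.aestronglyMeasurable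

theorem charFn_eq_mul_charFn_rotated (θ : ℝ) (ν : ProbabilityMeasure (Torus d)) (p : Fin d → ℤ) :
    charFn (ν : Measure (Torus d)) p =
      monomial p (centering θ ν) * charFn (rotated θ ν) p := by
  unfold charFn
  rw [integral_rotated θ ν (continuous_monomial p), ← integral_const_mul]
  refine integral_congr_ae (Eventually.of_forall fun s => ?_)
  change _ = monomial p _ * monomial p _
  rw [← monomial_mul, mul_inv_cancel_left]

theorem integral_gap_rotated_le (θ : ℝ) (ν : ProbabilityMeasure (Torus d)) :
    ∫ s, gap s ∂(rotated θ ν) ≤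
      2 * gap (centering θ ν) + 2 * ∫ s, gap s ∂(ν : Measure (Torus d)) := by
  have hg := integrable_gap_of_finite (ν : Measure (Torus d))
  rw [integral_rotated θ ν continuous_gap]
  have h1 : ∫ s, (2 * gap (centering θ ν) + 2 * gap s) ∂(ν : Measure (Torus d)) =
      2 * gap (centering θ ν) + 2 * ∫ s, gap s ∂(ν : Measure (Torus d)) := by
    rw [integral_add (integrable_const _) (hg.const_mul _)]; simp [integral_const_mul]
  rw [← h1]
  refine integral_mono (integrable_of_continuous (by fun_prop))
    ((integrable_const _).add (hg.const_mul _)) fun s => ?_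
  have := gap_mul_le (centering θ ν)⁻¹ s
  rwa [gap_inv] at this

/-- The centering removes the first-order part of a law concentrated near the unit: since the
truncated mean argument is subtracted, only quadratic errors remain. -/
theorem isCentered_rotated {θ : ℝ} (hθ₀ : 0 < θ) (hθ₁ : θ < 1) (ν : ProbabilityMeasure (Torus d))
    (hb : gap (centering θ ν) ≤ θ ^ 2 / 20) :
    IsCentered (15 + 40 / θ ^ 2) (rotated θ ν) := by
  intro j
  set β := meanArg θ ν j with hβ
  have hβ1 : |β| ≤ θ := abs_meanArg_le_radius hθ₀ ν j
  have hrot : ∀ s : Torus d, ((centering θ ν)⁻¹ * s) j =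
      Circle.exp (Complex.arg (s j : ℂ) - β) := by
    intro s
    rw [sub_eq_neg_add, Circle.exp_add, Circle.exp_arg, Circle.exp_neg]
    rfl
  have him : ∀ s : Torus d, ((((centering θ ν)⁻¹ * s) j : Circle) : ℂ).im =
      Real.sin (Complex.arg (s j : ℂ) - β) := fun s => by
    rw [hrot, Circle.coe_exp, Complex.exp_ofReal_mul_I_im]
  have hre : ∀ s : Torus d, ((((centering θ ν)⁻¹ * s) j : Circle) : ℂ).re =
      Real.cos (Complex.arg (s j : ℂ) - β) := fun s => by
    rw [hrot, Circle.coe_exp, Complex.exp_ofReal_mul_I_re]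
  have hcont : Continuous fun s : Torus d => ((((centering θ ν)⁻¹ * s) j : Circle) : ℂ).im := by
    simp only [Pi.mul_apply]; fun_prop
  have i1 : Integrable (fun s : Torus d => ((((centering θ ν)⁻¹ * s) j : Circle) : ℂ).im)
      (ν : Measure (Torus d)) := integrable_of_continuous hcont
  have i2 : Integrable ((nhd d θ).indicator fun s : Torus d => Complex.arg (s j : ℂ))
      (ν : Measure (Torus d)) := (integrable_arg ν j).indicator (measurableSet_nhd θ)
  have i3 : Integrable (fun s : Torus d => gap ((centering θ ν)⁻¹ * s))
      (ν : Measure (Torus d)) := integrable_of_continuous (by fun_prop)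
  have hG : ∫ s : Torus d, (s j : ℂ).im ∂(rotated θ ν) =
      ∫ s : Torus d, (((((centering θ ν)⁻¹ * s) j : Circle) : ℂ).im -
        (nhd d θ).indicator (fun s : Torus d => Complex.arg (s j : ℂ)) s + β)
        ∂(ν : Measure (Torus d)) := by
    have i4 : Integrable (fun s : Torus d => ((((centering θ ν)⁻¹ * s) j : Circle) : ℂ).im -
        (nhd d θ).indicator (fun s : Torus d => Complex.arg (s j : ℂ)) s)
        (ν : Measure (Torus d)) := i1.sub i2
    rw [integral_rotated θ ν (F := fun s : Torus d => (s j : ℂ).im) (by fun_prop),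
      integral_add i4 (integrable_const _), integral_sub i1 i2,
      integral_indicator (measurableSet_nhd θ)]
    have h2 : ∫ s in nhd d θ, Complex.arg (s j : ℂ) ∂(ν : Measure (Torus d)) = β := rfl
    rw [h2]; simp
  rw [hG, integral_rotated θ ν continuous_gap, ← integral_const_mul, ← Real.norm_eq_abs]
  refine norm_integral_le_of_norm_le (i3.const_mul _) (Eventually.of_forall fun s => ?_)
  have hg0 := gap_nonneg ((centering θ ν)⁻¹ * s)
  have hθ2 : 0 < θ ^ 2 := by positivity
  rw [Real.norm_eq_abs, add_mul]
  by_cases hs : s ∈ nhd d θ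
  · rw [Set.indicator_of_mem hs, him]
    set y := Complex.arg (s j : ℂ) - β with hy
    have h1 : |y| ≤ Real.pi := by
      have h2 := (abs_arg_lt_of_mem_nhd hs j).le
      have h3 := abs_sub (Complex.arg (s j : ℂ)) β
      have := Real.pi_gt_three
      linarith
    have h4 : Real.sin y - Complex.arg (s j : ℂ) + β = Real.sin y - y := by rw [hy]; ring
    rw [h4]
    have h5 := abs_sin_sub_le_sq y
    have h6 := sq_le_five_mul h1
    have h7 := one_sub_re_le_gap ((centering θ ν)⁻¹ * s) j
    rw [hre] at h7
    have h8 : 0 ≤ 40 / θ ^ 2 * gap ((centering θ ν)⁻¹ * s) := by positivity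
    linarith
  · rw [Set.indicator_of_notMem hs, sub_zero, him]
    have h1 : θ ^ 2 / 5 ≤ gap s := by
      by_contra h'
      exact hs (mem_nhd_of_gap_lt hθ₀ (not_le.1 h'))
    have h2 := gap_mul_le (centering θ ν) ((centering θ ν)⁻¹ * s)
    rw [mul_inv_cancel_left] at h2
    have h3 : θ ^ 2 / 20 ≤ gap ((centering θ ν)⁻¹ * s) := by linarith
    have h4 : 2 ≤ 40 / θ ^ 2 * gap ((centering θ ν)⁻¹ * s) := by
      rw [div_mul_eq_mul_div, le_div_iff₀ hθ2]; linarith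
    have h5 := abs_add_le (Real.sin (Complex.arg (s j : ℂ) - β)) β
    have h6 := Real.abs_sin_le_one (Complex.arg (s j : ℂ) - β)
    linarith

/-! ### Infinitesimal arrays -/

theorem IsInfinitesimal.eventually_integral_gap_le {k : ℕ → ℕ}
    {ν : (n : ℕ) → Fin (k n) → ProbabilityMeasure (Torus d)} (hν : IsInfinitesimal k ν) {η : ℝ}
    (hη : 0 < η) :
    ∀ᶠ n in atTop, ∀ i, ∫ s, gap s ∂(ν n i : Measure (Torus d)) ≤ η := by
  set ε := √(η / (2 * (d + 1))) with hε
  have hε0 : 0 < ε := by positivity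
  have hε2 : ε ^ 2 = η / (2 * (d + 1)) := Real.sq_sqrt (by positivity)
  set δ := η / (4 * (d + 1)) with hδ
  have hδ0 : 0 < δ := by positivity
  have h := (hν.tendsto ε hε0).eventually (ge_mem_nhds (ENNReal.ofReal_pos.2 hδ0))
  filter_upwards [h] with n hn i
  set S : Set (Torus d) := {s | ε ≤ dist s 1} with hS
  have hSm : MeasurableSet S := measurableSet_le measurable_const (by fun_prop)
  have h1 : (ν n i : Measure (Torus d)).real S ≤ δ := by
    rw [measureReal_def]
    exact ENNReal.toReal_le_of_le_ofReal hδ0.le ((le_iSup (fun i =>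
      (ν n i : Measure (Torus d)) S) i).trans hn)
  have h2 : ∫ s, gap s ∂(ν n i : Measure (Torus d)) ≤
      ∫ s, (d * ε ^ 2 + S.indicator (fun _ => (2 * d : ℝ)) s) ∂(ν n i : Measure (Torus d)) := by
    refine integral_mono (integrable_gap_of_finite _)
      ((integrable_const _).add ((integrable_const _).indicator hSm)) fun s => ?_
    by_cases hs : s ∈ S
    · have := gap_le s
      have h3 : 0 ≤ d * ε ^ 2 := by positivity
      simp only [Set.indicator_of_mem hs]; linarith
    · have h3 : dist s 1 ≤ ε := (not_le.1 hs).le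
      have h4 := gap_le_dist_sq s
      have h5 := pow_le_pow_left₀ dist_nonneg h3 2
      simp only [Set.indicator_of_notMem hs, add_zero]
      exact h4.trans (mul_le_mul_of_nonneg_left h5 (Nat.cast_nonneg d))
  rw [integral_add (integrable_const _) ((integrable_const _).indicator hSm),
    integral_indicator_const _ hSm] at h2
  simp only [integral_const, probReal_univ, smul_eq_mul, one_mul] at h2
  have hd : (0 : ℝ) ≤ d := Nat.cast_nonneg d
  refine h2.trans ?_
  calc d * ε ^ 2 + (ν n i : Measure (Torus d)).real S * (2 * d)
      ≤ d * (η / (2 * (d + 1))) + δ * (2 * d) := by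
        rw [hε2]; gcongr
    _ = η * (d / (d + 1)) := by rw [hδ]; field_simp; ring
    _ ≤ η * 1 := by
        gcongr
        rw [div_le_one (by positivity)]; linarith
    _ = η := mul_one η

/-- Centering keeps an array infinitesimal, and eventually all its laws are centered. -/
theorem IsInfinitesimal.eventually_rotated {k : ℕ → ℕ}
    {ν : (n : ℕ) → Fin (k n) → ProbabilityMeasure (Torus d)} (hν : IsInfinitesimal k ν)
    {θ : ℝ} (hθ₀ : 0 < θ) (hθ₁ : θ < 1) {η : ℝ} (hη : 0 < η) :
    ∀ᶠ n in atTop, ∀ i, IsCentered (15 + 40 / θ ^ 2) (rotated θ (ν n i)) ∧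
      ∫ s, gap s ∂(rotated θ (ν n i)) ≤ η := by
  set η' := min η (θ ^ 2 / 20) with hη'
  have hη'0 : 0 < η' := lt_min hη (by positivity)
  have hd : (0 : ℝ) ≤ d := Nat.cast_nonneg d
  set lam := √(η' / (4 * d + 1)) with hlam
  have hlam0 : 0 < lam := by positivity
  have hlam2 : lam ^ 2 * (4 * d + 1) = η' := by
    rw [hlam, Real.sq_sqrt (by positivity)]; field_simp
  filter_upwards [hν.eventually_integral_gap_le (η := lam ^ 2 / 5) (by positivity)] with n hn i
  have h1 : ∀ j, |meanArg θ (ν n i) j| ≤ 2 * lam := fun j => by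
    refine (abs_meanArg_le hlam0 (ν n i) j).trans ?_
    have h2 : 5 / lam * ∫ s, gap s ∂(ν n i : Measure (Torus d)) ≤ 5 / lam * (lam ^ 2 / 5) :=
      mul_le_mul_of_nonneg_left (hn i) (by positivity)
    have h3 : 5 / lam * (lam ^ 2 / 5) = lam := by field_simp
    linarith
  have h2 : gap (centering θ (ν n i)) ≤ 2 * d * lam ^ 2 := by
    refine (gap_exp_le h1).trans (le_of_eq ?_); ring
  have h3 : 0 < lam ^ 2 := by positivity
  refine ⟨isCentered_rotated hθ₀ hθ₁ _ ?_, ?_⟩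
  · refine h2.trans (le_trans ?_ (min_le_right η _))
    rw [← hη', ← hlam2]; nlinarith
  · refine (integral_gap_rotated_le θ (ν n i)).trans (le_trans ?_ (min_le_left _ (θ ^ 2 / 20)))
    rw [← hη', ← hlam2]
    have := hn i
    nlinarith

theorem integral_rowMeasure {E : Type*} [NormedAddCommGroup E] [NormedSpace ℝ E]
    [SecondCountableTopologyEither (Torus d) E] (θ : ℝ)
    {m : ℕ} (ν : Fin m → ProbabilityMeasure (Torus d)) {F : Torus d → E} (hF : Continuous F) :
    ∫ s, F s ∂(rowMeasure θ ν) = ∑ i, ∫ s, F s ∂(rotated θ (ν i)) :=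
  integral_finsetSum_measure fun _ _ => integrable_of_continuous hF

/-- The characteristic function of the accompanying compound Poisson law of a row: the
Lévy–Khintchine formula with drift `γₙ`, no Gaussian part and the row measure `ρₙ` in place of the
Lévy measure. -/
noncomputable def accompanying (θ : ℝ) (ξ : Torus d) {m : ℕ}
    (ν : Fin m → ProbabilityMeasure (Torus d)) (p : Fin d → ℤ) : ℂ :=
  monomial p (rowDrift θ ξ ν) * Complex.exp (∫ s, lkIntegrand p s ∂(rowMeasure θ ν))

theorem rowDrift_eq (θ : ℝ) (ξ : Torus d) {m : ℕ} (ν : Fin m → ProbabilityMeasure (Torus d)) :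
    rowDrift θ ξ ν = ξ * ∏ i, (centering θ (ν i) *
      fun j => Circle.exp (∫ s : Torus d, (s j : ℂ).im ∂(rotated θ (ν i)))) := by
  have hexp : ∀ (t : Finset (Fin m)) (f : Fin m → ℝ),
      Circle.exp (∑ i ∈ t, f i) = ∏ i ∈ t, Circle.exp (f i) := by
    intro t f
    induction t using Finset.induction_on with
    | empty => simp
    | insert i t hi ih => rw [Finset.sum_insert hi, Finset.prod_insert hi, Circle.exp_add, ih]
  funext j
  rw [Pi.mul_apply, Finset.prod_apply]
  unfold rowDrift
  rw [hexp]
  congr 1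
  refine Finset.prod_congr rfl fun i _ => ?_
  rw [Circle.exp_add, Circle.exp_arg]; rfl

theorem accompanying_eq (θ : ℝ) (ξ : Torus d) {m : ℕ}
    (ν : Fin m → ProbabilityMeasure (Torus d)) (p : Fin d → ℤ) :
    accompanying θ ξ ν p = monomial p ξ * ∏ i, (monomial p (centering θ (ν i)) *
      Complex.exp (charFn (rotated θ (ν i)) p - 1)) := by
  rw [accompanying, integral_rowMeasure θ ν (continuous_lkIntegrand p), rowDrift_eq, monomial_mul,
    monomial_prod, Complex.exp_sum, mul_assoc, ← Finset.prod_mul_distrib]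
  congr 1
  refine Finset.prod_congr rfl fun i _ => ?_
  rw [monomial_mul, monomial_exp, charFn_sub_one_eq, Complex.exp_add]
  ring

theorem norm_prod_sub_prod_le {ι : Type*} (t : Finset ι) {z w : ι → ℂ} (hz : ∀ i, ‖z i‖ ≤ 1)
    (hw : ∀ i, ‖w i‖ ≤ 1) : ‖∏ i ∈ t, z i - ∏ i ∈ t, w i‖ ≤ ∑ i ∈ t, ‖z i - w i‖ := by
  classical
  induction t using Finset.induction_on with
  | empty => simp
  | insert i t hi ih =>
    rw [Finset.prod_insert hi, Finset.prod_insert hi, Finset.sum_insert hi]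
    have h1 : z i * ∏ i ∈ t, z i - w i * ∏ i ∈ t, w i =
        (z i - w i) * ∏ i ∈ t, z i + w i * (∏ i ∈ t, z i - ∏ i ∈ t, w i) := by ring
    have h2 : ‖∏ i ∈ t, z i‖ ≤ 1 := by
      rw [norm_prod]; exact Finset.prod_le_one (fun _ _ => norm_nonneg _) fun i _ => hz i
    rw [h1]
    refine (norm_add_le _ _).trans (add_le_add ?_ ?_)
    · rw [norm_mul]; exact mul_le_of_le_one_right (norm_nonneg _) h2
    · rw [norm_mul]
      exact (mul_le_of_le_one_left (norm_nonneg _) (hw i)).trans ih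

/-- Rows of an infinitesimal array are close to their accompanying infinitely divisible laws. -/
theorem IsInfinitesimal.exists_norm_charFn_rowConv_sub_le {k : ℕ → ℕ}
    {ν : (n : ℕ) → Fin (k n) → ProbabilityMeasure (Torus d)} (hν : IsInfinitesimal k ν)
    {θ : ℝ} (hθ₀ : 0 < θ) (hθ₁ : θ < 1) (p : Fin d → ℤ) {η : ℝ} (hη : 0 < η) :
    ∀ᶠ n in atTop, ∀ ξ : Torus d,
      ‖charFn (rowConv ξ (ν n) : Measure (Torus d)) p - accompanying θ ξ (ν n) p‖ ≤
        η * ∫ s, gap s ∂(rowMeasure θ (ν n)) := by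
  obtain ⟨K, hK, hKle⟩ := exists_norm_charFn_sub_one_le (d := d) (15 + 40 / θ ^ 2) p
  have hη' : 0 < min (1 / K) (η / K ^ 2) := lt_min (by positivity) (by positivity)
  filter_upwards [hν.eventually_rotated hθ₀ hθ₁ hη'] with n hn ξ
  have hz : ∀ i, ‖charFn (rotated θ (ν n i)) p‖ ≤ 1 := fun i => norm_charFn_le_one _ _
  have hw : ∀ i, ‖Complex.exp (charFn (rotated θ (ν n i)) p - 1)‖ ≤ 1 := fun i => by
    rw [Complex.norm_exp, Real.exp_le_one_iff, Complex.sub_re, Complex.one_re]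
    linarith [(Complex.re_le_norm _).trans (hz i)]
  rw [charFn_rowConv, accompanying_eq, ← mul_sub, norm_mul, norm_monomial, one_mul]
  simp only [charFn_eq_mul_charFn_rotated θ]
  refine (norm_prod_sub_prod_le _ (fun i => by rw [norm_mul, norm_monomial, one_mul]; exact hz i)
    (fun i => by rw [norm_mul, norm_monomial, one_mul]; exact hw i)).trans ?_
  rw [integral_rowMeasure θ (ν n) continuous_gap, Finset.mul_sum]
  refine Finset.sum_le_sum fun i _ => ?_
  rw [← mul_sub, norm_mul, norm_monomial, one_mul]
  set u := charFn (rotated θ (ν n i)) p - 1 with hu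
  set a := ∫ s, gap s ∂(rotated θ (ν n i)) with ha
  have ha0 : 0 ≤ a := integral_gap_nonneg _
  have h1 : ‖u‖ ≤ K * a := hKle _ inferInstance (hn i).1
  have h2 : K * a ≤ 1 := by
    have := (hn i).2.trans (min_le_left _ _)
    rw [le_div_iff₀ hK] at this; linarith
  have h3 : K ^ 2 * a ≤ η := by
    have := (hn i).2.trans (min_le_right _ _)
    rw [le_div_iff₀ (by positivity)] at this; linarith
  have h4 := Complex.norm_exp_sub_one_sub_id_le (h1.trans h2)
  have h5 : charFn (rotated θ (ν n i)) p - Complex.exp u = -(Complex.exp u - 1 - u) := by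
    rw [hu]; ring
  rw [h5, norm_neg]
  have h6 := pow_le_pow_left₀ (norm_nonneg _) h1 2
  nlinarith

theorem IsInfinitesimal.tendsto_charFn_rowConv_sub {k : ℕ → ℕ}
    {ν : (n : ℕ) → Fin (k n) → ProbabilityMeasure (Torus d)} (hν : IsInfinitesimal k ν)
    {θ : ℝ} (hθ₀ : 0 < θ) (hθ₁ : θ < 1) (ξ : ℕ → Torus d) {ns : ℕ → ℕ}
    (hns : Tendsto ns atTop atTop) {M : ℝ}
    (hM : ∀ᶠ m in atTop, ∫ s, gap s ∂(rowMeasure θ (ν (ns m))) ≤ M) (p : Fin d → ℤ) :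
    Tendsto (fun m => charFn (rowConv (ξ (ns m)) (ν (ns m)) : Measure (Torus d)) p -
      accompanying θ (ξ (ns m)) (ν (ns m)) p) atTop (𝓝 0) := by
  rw [tendsto_zero_iff_norm_tendsto_zero]
  refine Metric.tendsto_nhds.2 fun ε hε => ?_
  have hM' : 0 < |M| + 1 := by positivity
  filter_upwards [hM, hns.eventually (hν.exists_norm_charFn_rowConv_sub_le hθ₀ hθ₁ p
    (η := ε / 2 / (|M| + 1)) (by positivity))] with m h1 h2
  rw [Real.dist_eq, sub_zero, abs_norm]
  calc _ ≤ _ := h2 (ξ (ns m))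
    _ ≤ ε / 2 / (|M| + 1) * (|M| + 1) := by
        gcongr
        linarith [le_abs_self M]
    _ = ε / 2 := by field_simp
    _ < ε := by linarith

/-- The total second-order size of a row is bounded through the first characteristic coefficients
of its convolution. -/
theorem IsInfinitesimal.eventually_prod_norm_sq_le {k : ℕ → ℕ}
    {ν : (n : ℕ) → Fin (k n) → ProbabilityMeasure (Torus d)} (hν : IsInfinitesimal k ν)
    {θ : ℝ} (hθ₀ : 0 < θ) (hθ₁ : θ < 1) :
    ∀ᶠ n in atTop, ∀ ξ : Torus d,
      ∏ j, ‖charFn (rowConv ξ (ν n) : Measure (Torus d)) (Pi.single j 1)‖ ^ 2 ≤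
        Real.exp (-∫ s, gap s ∂(rowMeasure θ (ν n))) := by
  obtain ⟨δ, hδ, h⟩ := exists_integral_gap_le d (15 + 40 / θ ^ 2)
  filter_upwards [hν.eventually_rotated hθ₀ hθ₁ hδ] with n hn ξ
  have h1 : ∀ j : Fin d, ‖charFn (rowConv ξ (ν n) : Measure (Torus d)) (Pi.single j 1)‖ ^ 2 =
      ∏ i, ‖charFn (rotated θ (ν n i)) (Pi.single j 1)‖ ^ 2 := by
    intro j
    rw [charFn_rowConv, norm_mul, norm_monomial, one_mul, norm_prod, Finset.prod_pow]
    simp only [charFn_eq_mul_charFn_rotated θ, norm_mul, norm_monomial, one_mul]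
  simp only [h1]
  rw [Finset.prod_comm, integral_rowMeasure θ (ν n) continuous_gap, ← Finset.sum_neg_distrib,
    Real.exp_sum]
  refine Finset.prod_le_prod (fun i _ => Finset.prod_nonneg fun j _ => by positivity) fun i _ => ?_
  calc ∏ j, ‖charFn (rotated θ (ν n i)) (Pi.single j 1)‖ ^ 2
      ≤ ∏ j : Fin d, Real.exp (-(1 - ‖charFn (rotated θ (ν n i)) (Pi.single j 1)‖ ^ 2)) := by
        refine Finset.prod_le_prod (fun j _ => by positivity) fun j _ => ?_
        have := Real.add_one_le_exp
          (-(1 - ‖charFn (rotated θ (ν n i)) (Pi.single j 1)‖ ^ 2))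
        linarith
    _ ≤ Real.exp (-∫ s, gap s ∂(rotated θ (ν n i))) := by
        rw [← Real.exp_sum, Finset.sum_neg_distrib]
        exact Real.exp_le_exp.2 (neg_le_neg (h _ inferInstance (hn i).1 (hn i).2))

/-! ### The class of Lévy measures of a Poisson-type distribution -/

theorem levyKhintchine_eq (γ : Torus d) (A : Matrix (Fin d) (Fin d) ℝ) (τ : Measure (Torus d))
    (p : Fin d → ℤ) :
    levyKhintchine γ A τ p = monomial p γ * (Complex.exp (-(quadForm A p : ℂ) / 2) *
      Complex.exp (∫ s, lkIntegrand p s ∂τ)) := by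
  rw [← Complex.exp_add]; rfl

theorem integral_lkIntegrand_single (τ : Measure (Torus d)) (j : Fin d) :
    ∫ s, lkIntegrand (Pi.single j 1) s ∂τ =
      ((∫ s, ((monomial (Pi.single j (1 : ℤ)) s).re - 1) ∂τ : ℝ) : ℂ) := by
  rw [← integral_complex_ofReal]
  refine integral_congr_ae (Eventually.of_forall fun s => ?_)
  apply Complex.ext
  · rw [lkIntegrand_re, Complex.ofReal_re]
  · simp [lkIntegrand, pairIm_single, monomial_single]

theorem isSymm_of_posSemidef {A : Matrix (Fin d) (Fin d) ℝ} (hA : A.PosSemidef) (j l : Fin d) :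
    A j l = A l j := by
  simpa using hA.isHermitian.apply l j

theorem realPart_eq_of_norm_levyKhintchine_eq {γ γ' : Torus d} {A A' : Matrix (Fin d) (Fin d) ℝ}
    {τ τ' : Measure (Torus d)} (h : Integrable gap τ) (h' : Integrable gap τ') {p : Fin d → ℤ}
    (heq : levyKhintchine γ A τ p = levyKhintchine γ' A' τ' p) :
    quadForm A p / 2 + ∫ s, (1 - (monomial p s).re) ∂τ =
      quadForm A' p / 2 + ∫ s, (1 - (monomial p s).re) ∂τ' := by
  have h1 := congrArg norm heq
  rw [norm_levyKhintchine _ _ h, norm_levyKhintchine _ _ h', Real.exp_eq_exp] at h1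
  linarith

/-- Lévy measures of the same Poisson-type distribution differ only through the imaginary part of
their exponents, by multiples of `2π`: the Gaussian part and the drift are forced. -/
theorem mem_levyClass_iff {ρ τ : Measure (Torus d)} (hρ : IsLevyMeasure ρ) :
    τ ∈ levyClass ρ ↔ IsLevyMeasure τ ∧ ∀ p,
      Complex.exp (∫ s, lkIntegrand p s ∂τ) = Complex.exp (∫ s, lkIntegrand p s ∂ρ) := by
  constructor
  · rintro ⟨ν, hν, γ', A', hν'⟩
    have hτ := hν'.triplet.levy
    have heq : ∀ p, levyKhintchine 1 0 ρ p = levyKhintchine γ' A' τ p := fun p => by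
      rw [← hν.charFn_eq, hν'.charFn_eq]
    have hreal := fun p => realPart_eq_of_norm_levyKhintchine_eq hρ.integrable_gap
      hτ.integrable_gap (heq p)
    have hA' : (0 : Matrix (Fin d) (Fin d) ℝ) = A' :=
      covariance_unique (fun _ _ => rfl) (isSymm_of_posSemidef hν'.triplet.posSemidef)
        hρ.integrable_gap hτ.integrable_gap hreal
    subst hA'
    have hreal' : ∀ p, ∫ s, ((monomial p s).re - 1) ∂ρ = ∫ s, ((monomial p s).re - 1) ∂τ := by
      intro p
      have h1 : ∀ μ : Measure (Torus d), ∫ s, ((monomial p s).re - 1) ∂μ =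
          -∫ s, (1 - (monomial p s).re) ∂μ := fun μ => by rw [← integral_neg]; simp
      rw [h1, h1]
      linarith [hreal p]
    have hγ' : γ' = 1 := by
      funext j
      have h1 := heq (Pi.single j 1)
      rw [levyKhintchine_eq, levyKhintchine_eq, integral_lkIntegrand_single,
        integral_lkIntegrand_single, hreal', monomial_one] at h1
      have h2 := mul_right_cancel₀ (mul_ne_zero (Complex.exp_ne_zero _) (Complex.exp_ne_zero _)) h1
      rw [monomial_single, zpow_one] at h2
      exact Circle.ext h2.symm
    subst hγ'
    refine ⟨hτ, fun p => ?_⟩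
    have h1 := heq p
    rw [levyKhintchine_eq, levyKhintchine_eq] at h1
    exact (mul_left_cancel₀ (Complex.exp_ne_zero _)
      (mul_left_cancel₀ (monomial_ne_zero _ _) h1)).symm
  · rintro ⟨hτ, heq⟩
    obtain ⟨ν, hν, -⟩ := existsUnique_hasLevyTriplet
      (γ := (1 : Torus d)) (A := 0) (ρ := ρ) ⟨Matrix.PosSemidef.zero, hρ⟩
    refine ⟨ν, hν, 1, 0, ⟨Matrix.PosSemidef.zero, hτ⟩, fun p => ?_⟩
    rw [hν.charFn_eq, levyKhintchine_eq, levyKhintchine_eq, heq]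

theorem integral_one_sub_re_eq_of_exp_eq {ρ τ : Measure (Torus d)} (hρ : Integrable gap ρ)
    (hτ : Integrable gap τ) {p : Fin d → ℤ}
    (h : Complex.exp (∫ s, lkIntegrand p s ∂τ) = Complex.exp (∫ s, lkIntegrand p s ∂ρ)) :
    ∫ s, (1 - (monomial p s).re) ∂τ = ∫ s, (1 - (monomial p s).re) ∂ρ := by
  have h1 : levyKhintchine (1 : Torus d) 0 τ p = levyKhintchine (1 : Torus d) 0 ρ p := by
    rw [levyKhintchine_eq, levyKhintchine_eq, h]
  simpa using realPart_eq_of_norm_levyKhintchine_eq hτ hρ h1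

/-! ### Iterated limits -/

/-- The iterated upper and lower limits both equal `a` iff `u ε n` is eventually in `n` close to
`a`, for all small `ε`. -/
theorem tendsto_limsup_and_liminf_iff {u : ℝ → ℕ → ℝ} {a : ℝ} :
    (Tendsto (fun ε => limsup (fun n => (u ε n : EReal)) atTop) (𝓝[>] 0) (𝓝 (a : EReal)) ∧
      Tendsto (fun ε => liminf (fun n => (u ε n : EReal)) atTop) (𝓝[>] 0) (𝓝 (a : EReal))) ↔
    ∀ η, 0 < η → ∀ᶠ ε in 𝓝[>] 0, ∀ᶠ n in atTop, |u ε n - a| ≤ η := by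
  constructor
  · rintro ⟨h1, h2⟩ η hη
    have ha1 : (a : EReal) < ((a + η : ℝ) : EReal) := EReal.coe_lt_coe_iff.2 (by linarith)
    have ha2 : ((a - η : ℝ) : EReal) < (a : EReal) := EReal.coe_lt_coe_iff.2 (by linarith)
    have e1 := h1.eventually (gt_mem_nhds ha1)
    have e2 := h2.eventually (lt_mem_nhds ha2)
    filter_upwards [e1, e2] with ε h3 h4
    filter_upwards [eventually_lt_of_limsup_lt h3, eventually_lt_of_lt_liminf h4] with n h5 h6
    rw [abs_le]
    constructor <;> linarith [EReal.coe_lt_coe_iff.1 h5, EReal.coe_lt_coe_iff.1 h6]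
  · intro h
    have hlow : ∀ b : EReal, b < a → ∀ᶠ ε in 𝓝[>] 0,
        b < liminf (fun n => (u ε n : EReal)) atTop := by
      intro b hb
      obtain ⟨c, hbc, hca⟩ := EReal.lt_iff_exists_real_btwn.1 hb
      filter_upwards [h (a - c) (sub_pos.2 (EReal.coe_lt_coe_iff.1 hca))] with ε hε
      refine hbc.trans_le (le_liminf_of_le (by isBoundedDefault) ?_)
      filter_upwards [hε] with n hn
      exact EReal.coe_le_coe_iff.2 (by linarith [(abs_le.1 hn).1])
    have hup : ∀ b : EReal, (a : EReal) < b → ∀ᶠ ε in 𝓝[>] 0,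
        limsup (fun n => (u ε n : EReal)) atTop < b := by
      intro b hb
      obtain ⟨c, hac, hcb⟩ := EReal.lt_iff_exists_real_btwn.1 hb
      filter_upwards [h (c - a) (sub_pos.2 (EReal.coe_lt_coe_iff.1 hac))] with ε hε
      refine lt_of_le_of_lt (limsup_le_of_le (by isBoundedDefault) ?_) hcb
      filter_upwards [hε] with n hn
      exact EReal.coe_le_coe_iff.2 (by linarith [(abs_le.1 hn).2])
    have hle : ∀ ε, liminf (fun n => (u ε n : EReal)) atTop ≤
        limsup (fun n => (u ε n : EReal)) atTop := fun ε => liminf_le_limsup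
    exact ⟨tendsto_order.2 ⟨fun b hb => (hlow b hb).mono fun ε hε => hε.trans_le (hle ε), hup⟩,
      tendsto_order.2 ⟨hlow, fun b hb => (hup b hb).mono fun ε hε => (hle ε).trans_lt hε⟩⟩

/-! ### Limits of rows -/

section Rows

variable {θ : ℝ} {γ : Torus d} {A : Matrix (Fin d) (Fin d) ℝ} {ρ : Measure (Torus d)}
  {k : ℕ → ℕ} {ν : (n : ℕ) → Fin (k n) → ProbabilityMeasure (Torus d)} {ξ : ℕ → Torus d}

/-- Convergence of the rows bounds their total second-order size. -/
theorem exists_integral_gap_rowMeasure_le (hθ₀ : 0 < θ) (hθ₁ : θ < 1) (hρ : IsLevyMeasure ρ)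
    (hν : IsInfinitesimal k ν)
    (hconv : ∀ p, Tendsto (fun n => charFn (rowConv (ξ n) (ν n) : Measure (Torus d)) p) atTop
      (𝓝 (levyKhintchine γ A ρ p))) :
    ∃ M, ∀ n, ∫ s, gap s ∂(rowMeasure θ (ν n)) ≤ M := by
  set L := ∏ j : Fin d, ‖levyKhintchine γ A ρ (Pi.single j 1)‖ ^ 2 with hL
  have hL0 : 0 < L := Finset.prod_pos fun j _ => by
    rw [norm_levyKhintchine _ _ hρ.integrable_gap]; positivity
  have h1 : Tendsto (fun n => ∏ j : Fin d,
      ‖charFn (rowConv (ξ n) (ν n) : Measure (Torus d)) (Pi.single j 1)‖ ^ 2) atTop (𝓝 L) :=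
    tendsto_finsetProd _ fun j _ => (hconv (Pi.single j 1)).norm.pow 2
  have h2 : ∀ᶠ n in atTop, ∫ s, gap s ∂(rowMeasure θ (ν n)) ≤ -Real.log (L / 2) := by
    filter_upwards [h1.eventually (lt_mem_nhds (half_lt_self hL0)),
      hν.eventually_prod_norm_sq_le hθ₀ hθ₁] with n h3 h4
    have h5 := h3.trans_le (h4 (ξ n))
    have h6 := (Real.log_lt_iff_lt_exp (by positivity)).2 h5
    linarith
  obtain ⟨N, hN⟩ := eventually_atTop.1 h2
  refine ⟨-Real.log (L / 2) ⊔ ∑ n ∈ Finset.range N, ∫ s, gap s ∂(rowMeasure θ (ν n)), fun n => ?_⟩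
  rcases le_or_gt N n with h | h
  · exact (hN n h).trans (le_max_left _ _)
  · refine le_trans ?_ (le_max_right _ _)
    exact Finset.single_le_sum (f := fun n => ∫ s, gap s ∂(rowMeasure θ (ν n)))
      (fun _ _ => integral_gap_nonneg _) (Finset.mem_range.2 h)

theorem tendsto_accompanying (hθ₀ : 0 < θ) (hθ₁ : θ < 1) (hν : IsInfinitesimal k ν)
    (hconv : ∀ p, Tendsto (fun n => charFn (rowConv (ξ n) (ν n) : Measure (Torus d)) p) atTop
      (𝓝 (levyKhintchine γ A ρ p))) {M : ℝ}
    (hM : ∀ n, ∫ s, gap s ∂(rowMeasure θ (ν n)) ≤ M) (p : Fin d → ℤ) :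
    Tendsto (fun n => accompanying θ (ξ n) (ν n) p) atTop (𝓝 (levyKhintchine γ A ρ p)) := by
  have h1 := (hconv p).sub
    (hν.tendsto_charFn_rowConv_sub hθ₀ hθ₁ ξ tendsto_id (Eventually.of_forall hM) p)
  simpa using h1

theorem tendsto_circle_iff {ι : Type*} {l : Filter ι} {f : ι → Circle} {z : Circle} :
    Tendsto f l (𝓝 z) ↔ Tendsto (fun i => (f i : ℂ)) l (𝓝 (z : ℂ)) := by
  have h : ∀ i, dist (f i) z = dist (f i : ℂ) (z : ℂ) := fun _ => rfl
  rw [tendsto_iff_dist_tendsto_zero, tendsto_iff_dist_tendsto_zero (f := fun i => (f i : ℂ))]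
  simp only [h]

theorem tendsto_monomial {ι : Type*} {l : Filter ι} {f : ι → Torus d} {s : Torus d}
    (h : Tendsto f l (𝓝 s)) (p : Fin d → ℤ) :
    Tendsto (fun i => monomial p (f i)) l (𝓝 (monomial p s)) :=
  ((continuous_monomial p).tendsto s).comp h

/-- In the frequencies `eⱼ` the exponents are real, so the drift is the phase of the first
characteristic coefficients. -/
theorem tendsto_rowDrift (hρ : IsLevyMeasure ρ)
    (hacc : ∀ p, Tendsto (fun n => accompanying θ (ξ n) (ν n) p) atTop
      (𝓝 (levyKhintchine γ A ρ p))) :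
    Tendsto (fun n => rowDrift θ (ξ n) (ν n)) atTop (𝓝 γ) := by
  refine tendsto_pi_nhds.2 fun j => tendsto_circle_iff.2 ?_
  have hphase : ∀ (z : ℂ) (x : ℝ), z * Complex.exp (x : ℂ) / (‖z * Complex.exp (x : ℂ)‖ : ℂ) =
      z / (‖z‖ : ℂ) := by
    intro z x
    rw [norm_mul, Complex.norm_exp_ofReal, Complex.ofReal_mul, Complex.ofReal_exp]
    exact mul_div_mul_right _ _ (Complex.exp_ne_zero _)
  have h1 : ∀ n, accompanying θ (ξ n) (ν n) (Pi.single j 1) /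
      (‖accompanying θ (ξ n) (ν n) (Pi.single j 1)‖ : ℂ) = (rowDrift θ (ξ n) (ν n) j : ℂ) := by
    intro n
    rw [accompanying, integral_lkIntegrand_single, hphase, monomial_single, zpow_one,
      Circle.norm_coe]
    simp
  have h2 : levyKhintchine γ A ρ (Pi.single j 1) /
      (‖levyKhintchine γ A ρ (Pi.single j 1)‖ : ℂ) = (γ j : ℂ) := by
    have h3 : levyKhintchine γ A ρ (Pi.single j 1) = (γ j : ℂ) * Complex.exp
        ((-(quadForm A (Pi.single j 1)) / 2 +
          ∫ s, ((monomial (Pi.single j (1 : ℤ)) s).re - 1) ∂ρ : ℝ) : ℂ) := by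
      rw [levyKhintchine_eq, integral_lkIntegrand_single, ← Complex.exp_add, monomial_single,
        zpow_one]
      push_cast; rfl
    rw [h3, hphase, Circle.norm_coe]
    simp
  have h0 : (‖levyKhintchine γ A ρ (Pi.single j 1)‖ : ℂ) ≠ 0 := by
    rw [norm_levyKhintchine _ _ hρ.integrable_gap]
    exact_mod_cast (Real.exp_pos _).ne'
  have h4 := (hacc (Pi.single j 1)).div
    ((Complex.continuous_ofReal.tendsto _).comp (hacc (Pi.single j 1)).norm) h0
  rw [h2] at h4
  exact h4.congr h1

/-- Every subsequential limit of the row measures has the covariance `A` and a Lévy measure from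
the class of `ρ`. -/
theorem condensedLimit_eq (hT : IsLevyTriplet γ A ρ)
    (hacc : ∀ p, Tendsto (fun n => accompanying θ (ξ n) (ν n) p) atTop
      (𝓝 (levyKhintchine γ A ρ p)))
    (hdrift : Tendsto (fun n => rowDrift θ (ξ n) (ν n)) atTop (𝓝 γ))
    {ns : ℕ → ℕ} (hns : Tendsto ns atTop atTop) {τ : Measure (Torus d)}
    {A' : Matrix (Fin d) (Fin d) ℝ}
    (h : CondensedLimit (fun m => rowMeasure θ (ν (ns m))) τ A') :
    A' = A ∧ τ ∈ levyClass ρ := by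
  have hρ := hT.levy
  have heq : ∀ p, levyKhintchine γ A' τ p = levyKhintchine γ A ρ p := by
    intro p
    refine tendsto_nhds_unique ?_ ((hacc p).comp hns)
    exact (tendsto_monomial (hdrift.comp hns) p).mul
      ((Complex.continuous_exp.tendsto _).comp (h.tendsto_lkIntegral p))
  have hA : A' = A := covariance_unique h.symm (isSymm_of_posSemidef hT.posSemidef)
    h.levy.integrable_gap hρ.integrable_gap fun p =>
      realPart_eq_of_norm_levyKhintchine_eq h.levy.integrable_gap hρ.integrable_gap (heq p)
  subst hA
  refine ⟨rfl, (mem_levyClass_iff hρ).2 ⟨h.levy, fun p => ?_⟩⟩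
  have h1 := heq p
  rw [levyKhintchine_eq, levyKhintchine_eq] at h1
  exact mul_left_cancel₀ (Complex.exp_ne_zero _) (mul_left_cancel₀ (monomial_ne_zero _ _) h1)

theorem vagueRelCompact_rows {M : ℝ} (hM : ∀ n, ∫ s, gap s ∂(rowMeasure θ (ν n)) ≤ M) :
    VagueRelCompact (Set.range fun n => (rowMeasure θ (ν n)).restrict {1}ᶜ) := by
  intro u hu
  choose n hn using hu
  obtain ⟨φ, hφ, τ, A', h⟩ := exists_subseq_condensedLimit
    (σ := fun m => rowMeasure θ (ν (n m))) (fun m => integrable_gap_of_finite _) fun m => hM _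
  refine ⟨φ, hφ, τ, h.levy.mem_puncturedMeasures, ?_⟩
  have h1 := h.vagueTendsto
  simp only [hn] at h1
  exact h1

/-- Small balls asymptotically carry exactly the Gaussian second moments. A failure along a
subsequence is excluded because the Lévy measures of all subsequential limits are uniformly
small near the unit. -/
theorem eventually_truncMoment (hT : IsLevyTriplet γ A ρ)
    (hacc : ∀ p, Tendsto (fun n => accompanying θ (ξ n) (ν n) p) atTop
      (𝓝 (levyKhintchine γ A ρ p)))
    (hdrift : Tendsto (fun n => rowDrift θ (ξ n) (ν n)) atTop (𝓝 γ)) {M : ℝ}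
    (hM : ∀ n, ∫ s, gap s ∂(rowMeasure θ (ν n)) ≤ M) (j l : Fin d) {η : ℝ} (hη : 0 < η) :
    ∀ᶠ ε in 𝓝[>] (0 : ℝ), ∀ᶠ n in atTop,
      |truncMoment (rowMeasure θ (ν n)) ε j l - A j l| ≤ η := by
  have hρ := hT.levy
  obtain ⟨r, hr, hnear⟩ := exists_forall_nearMass_le hρ.integrable_gap (η := η / 8) (by positivity)
  filter_upwards [Ioo_mem_nhdsGT (show (0 : ℝ) < √(r / 2) by positivity)] with ε hε
  have hε2 : 2 * ε ^ 2 ≤ r := by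
    have h1 := pow_le_pow_left₀ hε.1.le hε.2.le 2
    rw [Real.sq_sqrt (by positivity)] at h1
    linarith
  by_contra hcon
  obtain ⟨φ, hφ, hbad⟩ := extraction_of_frequently_atTop (not_eventually.1 hcon)
  obtain ⟨ψ, hψ, τ, A', h⟩ := exists_subseq_condensedLimit
    (σ := fun m => rowMeasure θ (ν (φ m))) (fun m => integrable_gap_of_finite _) fun m => hM _
  obtain ⟨hA, hτ⟩ := condensedLimit_eq hT hacc hdrift
    (hφ.tendsto_atTop.comp hψ.tendsto_atTop) h
  have hτ' := (mem_levyClass_iff hρ).1 hτ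
  have h1 := hnear τ h.levy.integrable_gap (fun p => integral_one_sub_re_eq_of_exp_eq
    hρ.integrable_gap h.levy.integrable_gap (hτ'.2 p)) _ hε2
  obtain ⟨n, hn⟩ := (h.eventually_abs_truncMoment_sub_le hε.1 (half_pos hη) j l).exists
  rw [hA] at hn
  exact hbad (ψ n) (by linarith)

/-- Bounded second moments near the unit together with vague convergence bound the total
second-order size. -/
theorem eventually_integral_gap_le {σ : ℕ → Measure (Torus d)} (hσ : ∀ n, IsFiniteMeasure (σ n))
    {τ : Measure (Torus d)} (hvague : VagueTendsto (fun n => (σ n).restrict {1}ᶜ) τ) {ε B : ℝ}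
    (hε : 0 < ε) (hε1 : ε < 1)
    (hB : ∀ᶠ n in atTop, ∀ j, truncMoment (σ n) ε j j ≤ B) :
    ∃ M, ∀ᶠ n in atTop, ∫ s, gap s ∂(σ n) ≤ M := by
  set a := ε ^ 2 / 5 with ha
  have ha0 : 0 < a := by positivity
  let f : BoundedContinuousFunction (Torus d) ℝ := BoundedContinuousFunction.mkOfCompact
    ⟨fun s => gap s * min 1 (max 0 (2 * gap s / a - 1)), by fun_prop⟩
  have hfapply : ∀ s, f s = gap s * min 1 (max 0 (2 * gap s / a - 1)) := fun s => rfl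
  have hf0 : ∀ s, 0 ≤ f s := fun s =>
    mul_nonneg (gap_nonneg s) (le_min zero_le_one (le_max_left _ _))
  have hfa : ∀ s, a ≤ gap s → f s = gap s := fun s hs => by
    have h1 : 1 ≤ 2 * gap s / a - 1 := by
      have : 2 ≤ 2 * gap s / a := (le_div_iff₀ ha0).2 (by linarith)
      linarith
    rw [hfapply, max_eq_right (by linarith), min_eq_left h1, mul_one]
  have hfaway : AwayFromOne (Function.support f) := by
    refine awayFromOne_of_le_gap (half_pos ha0) fun s hs => ?_
    by_contra h'
    refine hs ?_
    have h1 : 2 * gap s / a ≤ 1 := (div_le_one ha0).2 (by linarith [not_le.1 h'])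
    rw [hfapply, max_eq_left (by linarith)]
    simp
  have hlim := hvague f hfaway
  simp only [integral_restrict_compl_one hfaway.apply_one] at hlim
  refine ⟨d * B + (∫ s, f s ∂τ + 1), ?_⟩
  filter_upwards [hB, hlim.eventually (gt_mem_nhds (lt_add_one _))] with n h1 h2
  have ii : ∀ j : Fin d, Integrable
      ((nhd d ε).indicator fun s : Torus d => (s j : ℂ).im * (s j : ℂ).im) (σ n) := fun j =>
    (integrable_im_mul_im (integrable_gap_of_finite (σ n)) j j).indicator (measurableSet_nhd ε)
  have iff' : Integrable (fun s => f s) (σ n) := integrable_of_continuous f.continuous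
  have h3 : ∫ s, gap s ∂(σ n) ≤ ∫ s, (∑ j : Fin d,
      (nhd d ε).indicator (fun s : Torus d => (s j : ℂ).im * (s j : ℂ).im) s + f s) ∂(σ n) := by
    refine integral_mono (integrable_gap_of_finite _)
      ((integrable_finsetSum _ fun j _ => ii j).add iff') fun s => ?_
    by_cases hs : s ∈ nhd d ε
    · simp only [Set.indicator_of_mem hs]
      have h4 : gap s ≤ ∑ j : Fin d, (s j : ℂ).im * (s j : ℂ).im :=
        Finset.sum_le_sum fun j _ => by
          have h5 := circle_im_sq (s j)
          have h6 := circle_re_le (s j)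
          have h7 : 0 ≤ (s j : ℂ).re := by
            rw [circle_re]
            have h8 := abs_lt.1 (abs_arg_lt_of_mem_nhd hs j)
            have := Real.pi_gt_three
            exact Real.cos_nonneg_of_mem_Icc ⟨by linarith, by linarith⟩
          nlinarith
      linarith [hf0 s]
    · have h4 : a ≤ gap s := by
        by_contra h'
        exact hs (mem_nhd_of_gap_lt hε (not_le.1 h'))
      simp only [Set.indicator_of_notMem hs, Finset.sum_const_zero, zero_add]
      exact (hfa s h4).ge
  rw [integral_add (integrable_finsetSum _ fun j _ => ii j) iff',
    integral_finsetSum _ fun j _ => ii j] at h3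
  have h4 : ∑ j : Fin d, ∫ s, (nhd d ε).indicator
      (fun s : Torus d => (s j : ℂ).im * (s j : ℂ).im) s ∂(σ n) ≤ d * B := by
    calc _ ≤ ∑ _j : Fin d, B := Finset.sum_le_sum fun j _ => by
          rw [integral_indicator (measurableSet_nhd ε)]
          exact h1 j
      _ = d * B := by simp
  linarith

/-- The three conditions imply convergence of the characteristic functions of the rows. -/
theorem tendsto_charFn_rowConv (hθ₀ : 0 < θ) (hθ₁ : θ < 1) (hT : IsLevyTriplet γ A ρ)
    (hν : IsInfinitesimal k ν)
    (hdrift : Tendsto (fun n => rowDrift θ (ξ n) (ν n)) atTop (𝓝 γ))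
    (hmom : ∀ j l, ∀ η, 0 < η → ∀ᶠ ε in 𝓝[>] (0 : ℝ), ∀ᶠ n in atTop,
      |truncMoment (rowMeasure θ (ν n)) ε j l - A j l| ≤ η)
    (hcpt : VagueRelCompact (Set.range fun n => (rowMeasure θ (ν n)).restrict {1}ᶜ))
    (hlim : ∀ τ : Measure (Torus d),
      IsVagueLimitPoint (fun n => (rowMeasure θ (ν n)).restrict {1}ᶜ) τ → τ ∈ levyClass ρ)
    (p : Fin d → ℤ) :
    Tendsto (fun n => charFn (rowConv (ξ n) (ν n) : Measure (Torus d)) p) atTop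
      (𝓝 (levyKhintchine γ A ρ p)) := by
  have hρ := hT.levy
  refine tendsto_of_subseq_tendsto fun ns hns => ?_
  obtain ⟨φ₀, -, hmono⟩ := strictMono_subseq_of_tendsto_atTop hns
  obtain ⟨φ₁, hφ₁, τ₁, -, hτ₁⟩ := hcpt
    (fun m => (rowMeasure θ (ν (ns (φ₀ m)))).restrict {1}ᶜ) fun m => ⟨_, rfl⟩
  have hns₁ : Tendsto (fun m => ns (φ₀ (φ₁ m))) atTop atTop := (hmono.comp hφ₁).tendsto_atTop
  obtain ⟨ε, hεB, hε0, hε1⟩ := (((eventually_all (l := 𝓝[>] (0 : ℝ))).2 fun j =>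
    hmom j j 1 one_pos).and (Ioo_mem_nhdsGT one_pos)).exists
  obtain ⟨M, hM⟩ := eventually_integral_gap_le (σ := fun m => rowMeasure θ (ν (ns (φ₀ (φ₁ m)))))
    (fun m => inferInstance) hτ₁ hε0 hε1 (B := ∑ j, |A j j| + 1) (by
      filter_upwards [hns₁.eventually (eventually_all.2 hεB)] with m hm j
      have h1 := (abs_le.1 (hm j)).2
      have h2 : |A j j| ≤ ∑ j, |A j j| :=
        Finset.single_le_sum (f := fun j => |A j j|) (fun _ _ => abs_nonneg _) (Finset.mem_univ j)
      linarith [le_abs_self (A j j)])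
  obtain ⟨N, hN⟩ := eventually_atTop.1 hM
  obtain ⟨φ₂, hφ₂, τ, A', h⟩ := exists_subseq_condensedLimit
    (σ := fun m => rowMeasure θ (ν (ns (φ₀ (φ₁ (m + N))))))
    (fun m => integrable_gap_of_finite _) fun m => hN _ (Nat.le_add_left _ _)
  set ms : ℕ → ℕ := fun m => φ₀ (φ₁ (φ₂ m + N)) with hms
  have hstrict : StrictMono fun m => ns (ms m) :=
    (hmono.comp hφ₁).comp fun a b hab => Nat.add_lt_add_right (hφ₂ hab) N
  have hτ := hlim τ ⟨h.levy.mem_puncturedMeasures, _, hstrict, h.vagueTendsto⟩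
  have hτ' := ((mem_levyClass_iff hρ).1 hτ).2
  have hA : A' = A := by
    ext j l
    refine eq_of_abs_sub_le_all fun η hη => ?_
    have hnear : Tendsto (fun ε : ℝ => nearMass τ (2 * ε ^ 2)) (𝓝[>] 0) (𝓝 0) := by
      refine (tendsto_nearMass h.levy.integrable_gap).comp (tendsto_nhdsWithin_iff.2 ⟨?_, ?_⟩)
      · have : Continuous fun ε : ℝ => 2 * ε ^ 2 := by fun_prop
        exact (this.tendsto' 0 0 (by simp)).mono_left nhdsWithin_le_nhds
      · filter_upwards [self_mem_nhdsWithin] with ε hε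
        have : (0 : ℝ) < ε := hε
        exact Set.mem_Ioi.2 (by positivity)
    obtain ⟨ε, ⟨h1, h2⟩, h3⟩ := (((hmom j l (η / 4) (by positivity)).and
      (hnear.eventually (gt_mem_nhds (show (0 : ℝ) < η / 16 by positivity)))).and
      self_mem_nhdsWithin).exists
    obtain ⟨n, h4, h5⟩ := ((hstrict.tendsto_atTop.eventually h1).and
      (h.eventually_abs_truncMoment_sub_le h3 (show (0 : ℝ) < η / 4 by positivity) j l)).exists
    rw [abs_le] at h4 h5 ⊢
    constructor <;> linarith [h4.1, h4.2, h5.1, h5.2]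
  subst hA
  refine ⟨ms, ?_⟩
  have h1 : Tendsto (fun m => accompanying θ (ξ (ns (ms m))) (ν (ns (ms m))) p) atTop
      (𝓝 (levyKhintchine γ A' ρ p)) := by
    have h2 : levyKhintchine γ A' ρ p = levyKhintchine γ A' τ p := by
      rw [levyKhintchine_eq, levyKhintchine_eq, hτ']
    rw [h2]
    exact (tendsto_monomial (hdrift.comp hstrict.tendsto_atTop) p).mul
      ((Complex.continuous_exp.tendsto _).comp (h.tendsto_lkIntegral p))
  have h2 := hν.tendsto_charFn_rowConv_sub hθ₀ hθ₁ ξ hstrict.tendsto_atTop (M := M)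
    (Eventually.of_forall fun m => hN _ (Nat.le_add_left _ _)) p
  simpa using h2.add h1

end Rows

end Torus

/-- There is exactly one distribution with the multiplicative Lévy triplet `(γ, A, ρ)`, and the
rows `δ_{ξ_n} ⊛ ν_{n1} ⊛ ⋯ ⊛ ν_{nk_n}` converge weakly to it iff the three conditions hold. -/
theorem theorem6p4 {d : ℕ} (θ : ℝ) (hθ₀ : 0 < θ) (hθ₁ : θ < 1)
    (γ : Torus d) (A : Matrix (Fin d) (Fin d) ℝ) (ρ : Measure (Torus d))
    (hT : Torus.IsLevyTriplet γ A ρ)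
    (k : ℕ → ℕ) (ν : (n : ℕ) → Fin (k n) → ProbabilityMeasure (Torus d))
    (hν : Torus.IsInfinitesimal k ν) (ξ : ℕ → Torus d) :
    (∃! ν₀ : ProbabilityMeasure (Torus d), Torus.HasLevyTriplet ν₀ γ A ρ) ∧
    ∀ ν₀ : ProbabilityMeasure (Torus d), Torus.HasLevyTriplet ν₀ γ A ρ →
      (Tendsto (fun n => Torus.rowConv (ξ n) (ν n)) atTop (𝓝 ν₀) ↔
        Tendsto (fun n => Torus.rowDrift θ (ξ n) (ν n)) atTop (𝓝 γ) ∧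
        (∀ j l : Fin d,
          Tendsto (fun ε : ℝ => limsup (fun n =>
              ((Torus.truncMoment (Torus.rowMeasure θ (ν n)) ε j l : ℝ) : EReal)) atTop)
            (𝓝[>] 0) (𝓝 ((A j l : ℝ) : EReal)) ∧
          Tendsto (fun ε : ℝ => liminf (fun n =>
              ((Torus.truncMoment (Torus.rowMeasure θ (ν n)) ε j l : ℝ) : EReal)) atTop)
            (𝓝[>] 0) (𝓝 ((A j l : ℝ) : EReal))) ∧
        Torus.VagueRelCompact
          (Set.range fun n => (Torus.rowMeasure θ (ν n)).restrict {1}ᶜ) ∧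
        ∀ τ : Measure (Torus d),
          Torus.IsVagueLimitPoint (fun n => (Torus.rowMeasure θ (ν n)).restrict {1}ᶜ) τ →
            τ ∈ Torus.levyClass ρ) := by
  refine ⟨Torus.existsUnique_hasLevyTriplet hT, fun ν₀ hν₀ => ?_⟩
  simp only [Torus.tendsto_limsup_and_liminf_iff]
  rw [Torus.tendsto_iff_charFn]
  simp only [hν₀.charFn_eq]
  constructor
  · intro hconv
    obtain ⟨M, hM⟩ := Torus.exists_integral_gap_rowMeasure_le hθ₀ hθ₁ hT.levy hν hconv
    have hacc := Torus.tendsto_accompanying hθ₀ hθ₁ hν hconv hM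
    have hdrift := Torus.tendsto_rowDrift hT.levy hacc
    refine ⟨hdrift, fun j l η hη => Torus.eventually_truncMoment hT hacc hdrift hM j l hη,
      Torus.vagueRelCompact_rows hM, ?_⟩
    rintro τ ⟨hτ, φ, hφ, hlim⟩
    obtain ⟨ψ, hψ, τ', A', h⟩ := Torus.exists_subseq_condensedLimit
      (σ := fun m => Torus.rowMeasure θ (ν (φ m)))
      (fun m => Torus.integrable_gap_of_finite _) fun m => hM _
    have hτ' := (Torus.condensedLimit_eq hT hacc hdrift
      (hφ.tendsto_atTop.comp hψ.tendsto_atTop) h).2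
    have huniq : τ = τ' := Torus.vague_limit_unique hτ h.levy.mem_puncturedMeasures
      (fun f hf => (hlim f hf).comp hψ.tendsto_atTop) h.vagueTendsto
    rwa [huniq]
  · rintro ⟨hdrift, hmom, hcpt, hlim⟩
    exact Torus.tendsto_charFn_rowConv hθ₀ hθ₁ hT hν hdrift hmom hcpt hlim
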